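/- Let $K$ be a field, $S$ an inverse monoid with set of idempotents $E(S)$, and $A$ a unital associative $K$-algebra. Let $\theta$ be a unital action of $S$ on $A$, i.e. a homomorphism $s\mapsto\theta_s$ from $S$ to the inverse monoid of partial bijections of $A$ such that $\theta_1=\mathrm{id}_A$ and each $\theta_s$ is an isomorphism of $K$-algebras between ideals of $A$ whose range is $1_sA$ for some central idempotent $1_s\in A$ (its domain is then $1_{s^{-1}}A$). Let $L=\bigoplus_{s\in S}1_sA\,\delta_s$ be the algebra with product $a\delta_s\cdot b\delta_t=a\,\theta_s(1_{s^{-1}}b)\,\delta_{st}$, and let $A\rtimes_\theta S$ be the quotient of $L$ by the two-sided ideal generated by all $a\delta_s-a\delta_t$ with $a\in 1_sA$ and $s\le t$, where $s\le t$ means $s=et$ for some $e\in E(S)$. Write $\overline{x}$ for the class of $x\in L$. Let $M$ be an $A\rtimes_\theta S$-bimodule on which the two induced actions of $K$ agree. Put $$M^A=\{x\in M:\ \overline{a\delta_1}\,x=x\,\overline{a\delta_1}\ \text{ for all } a\in A\};$$ this is a left module over the semigroup algebra $KS$ via $s\cdot x=\overline{1_s\delta_s}\,x\,\overline{1_{s^{-1}}\delta_{s^{-1}}}$.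 For a left $KS$-module $V$ let $H^n(S,V)=\mathrm{Ext}^n_{KS}(KE(S),V)$, where $KE(S)$ is the $K$-vector space with basis $E(S)$ and $s\cdot e=ses^{-1}$. For a $K$-algebra $R$ and an $R$-bimodule $N$ let $H^n(R,N)=\mathrm{Ext}^n_{R\otimes_K R^{\mathrm{op}}}(R,N)$ be the Hochschild cohomology. If $A$ is separable over $K$, i.e. projective as a left $A\otimes_K A^{\mathrm{op}}$-module, then for every such $M$ and every integer $n\ge 0$ there is an isomorphism of $K$-vector spaces $$H^n(S,M^A)\;\cong\; H^n(A\rtimes_\theta S,\,M).$$ -/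

import Mathlib

open scoped TensorProduct

universe u

/-! ### Inverse monoids -/

/-- An inverse monoid: every `s` has a unique `s⁻¹` with `s s⁻¹ s = s` and `s⁻¹ s s⁻¹ = s⁻¹`. -/
class InverseMonoid (S : Type*) extends Monoid S, Inv S where
  mul_inv_mul : ∀ s : S, s * s⁻¹ * s = s
  inv_mul_inv : ∀ s : S, s⁻¹ * s * s⁻¹ = s⁻¹
  inv_unique : ∀ s t : S, s * t * s = s → t * s * t = t → t = s⁻¹

namespace InverseMonoid

variable {S : Type*} [InverseMonoid S]

theorem inv_inv' (s : S) : s⁻¹⁻¹ = s :=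
  (inv_unique s⁻¹ s (inv_mul_inv s) (mul_inv_mul s)).symm

theorem inv_of_idem {e : S} (he : IsIdempotentElem e) : e⁻¹ = e := by
  have h : e * e * e = e := by rw [he.eq, he.eq]
  exact (inv_unique e e h h).symm

theorem idem_mul {e f : S} (he : IsIdempotentElem e) (hf : IsIdempotentElem f) :
    IsIdempotentElem (e * f) := by
  have he' : ∀ x, e * (e * x) = e * x := fun x => by rw [← mul_assoc, he.eq]
  have hf' : ∀ x, f * (f * x) = f * x := fun x => by rw [← mul_assoc, hf.eq]
  have h1 := mul_inv_mul (e * f)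
  have h2 := inv_mul_inv (e * f)
  set x := (e * f)⁻¹ with hx
  have h2' : x * (e * (f * x)) = x := by simpa [mul_assoc] using h2
  have h2'' : ∀ y, x * (e * (f * (x * y))) = x * y := fun y => by
    conv_rhs => rw [← h2']
    simp [mul_assoc]
  have hfx : f * x * e = x := by
    refine inv_unique (e * f) (f * x * e) ?_ ?_
    · simpa [mul_assoc, he', hf'] using h1
    · simp [mul_assoc, he', hf', h2'']
  have hxx : IsIdempotentElem x := by
    have : (f * x * e) * (f * x * e) = f * x * e := by
      simp [mul_assoc, h2'']
    rwa [hfx] at this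
  have : e * f = x := by
    rw [← inv_of_idem hxx, hx, inv_inv']
  rwa [this]

theorem idem_comm {e f : S} (he : IsIdempotentElem e) (hf : IsIdempotentElem f) :
    e * f = f * e := by
  have he' : ∀ x, e * (e * x) = e * x := fun x => by rw [← mul_assoc, he.eq]
  have hf' : ∀ x, f * (f * x) = f * x := fun x => by rw [← mul_assoc, hf.eq]
  have hef := idem_mul he hf
  have hfe := idem_mul hf he
  have h : f * e = (e * f)⁻¹ := by
    refine inv_unique _ _ ?_ ?_
    · have := hef.eq
      simp only [mul_assoc, he', hf'] at this ⊢
      exact this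
    · have := hfe.eq
      simp only [mul_assoc, he', hf'] at this ⊢
      exact this
  rw [h, inv_of_idem hef]

theorem idem_inv_mul (s : S) : IsIdempotentElem (s⁻¹ * s) := by
  change s⁻¹ * s * (s⁻¹ * s) = s⁻¹ * s
  rw [← mul_assoc, inv_mul_inv]

theorem idem_mul_inv (s : S) : IsIdempotentElem (s * s⁻¹) := by
  change s * s⁻¹ * (s * s⁻¹) = s * s⁻¹
  rw [← mul_assoc, mul_inv_mul]

theorem mul_inv_rev' (s t : S) : (s * t)⁻¹ = t⁻¹ * s⁻¹ := by
  have hc := idem_comm (idem_mul_inv t) (idem_inv_mul s)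
  refine (inv_unique (s * t) (t⁻¹ * s⁻¹) ?_ ?_).symm
  · calc s * t * (t⁻¹ * s⁻¹) * (s * t) = s * ((t * t⁻¹) * (s⁻¹ * s)) * t := by simp [mul_assoc]
      _ = (s * s⁻¹ * s) * (t * t⁻¹ * t) := by rw [hc]; simp [mul_assoc]
      _ = s * t := by rw [mul_inv_mul, mul_inv_mul]
  · calc t⁻¹ * s⁻¹ * (s * t) * (t⁻¹ * s⁻¹) = t⁻¹ * ((s⁻¹ * s) * (t * t⁻¹)) * s⁻¹ := by
          simp [mul_assoc]
      _ = (t⁻¹ * t * t⁻¹) * (s⁻¹ * s * s⁻¹) := by rw [← hc]; simp [mul_assoc]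
      _ = t⁻¹ * s⁻¹ := by rw [inv_mul_inv, inv_mul_inv]

theorem inv_one' : (1 : S)⁻¹ = 1 := inv_of_idem (one_mul 1)

theorem idem_conj (s : S) {e : S} (he : IsIdempotentElem e) : IsIdempotentElem (s * e * s⁻¹) := by
  have hc := idem_comm he (idem_inv_mul s)
  change s * e * s⁻¹ * (s * e * s⁻¹) = s * e * s⁻¹
  calc s * e * s⁻¹ * (s * e * s⁻¹) = s * (e * (s⁻¹ * s)) * e * s⁻¹ := by simp [mul_assoc]
    _ = (s * s⁻¹ * s) * (e * e) * s⁻¹ := by rw [hc]; simp [mul_assoc]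
    _ = s * e * s⁻¹ := by rw [mul_inv_mul, he.eq]

/-- The natural partial order: `s ≤ t` iff `s = e t` for some idempotent `e`. -/
def NatLE (s t : S) : Prop := ∃ e : S, IsIdempotentElem e ∧ s = e * t

variable (S) in
/-- The set `E(S)` of idempotents of `S`. -/
abbrev Idem : Type _ := {e : S // IsIdempotentElem e}

/-- The idempotent `s e s⁻¹`. -/
def conjIdem (s : S) (e : Idem S) : Idem S := ⟨s * e.1 * s⁻¹, idem_conj s e.2⟩

variable (S) in
/-- The trivial module `K E(S)`: the free `K`-module on `E(S)` with `s · e = s e s⁻¹`. -/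
noncomputable def idemRep (K : Type*) [CommRing K] : Representation K S (Idem S →₀ K) where
  toFun s := Finsupp.lmapDomain K K (conjIdem s)
  map_one' := by
    refine Finsupp.lhom_ext fun e k => ?_
    have : conjIdem (1 : S) e = e := Subtype.ext (by simp [conjIdem, inv_one'])
    simp [Finsupp.mapDomain_single, this]
  map_mul' s t := by
    refine Finsupp.lhom_ext fun e k => ?_
    have : conjIdem (s * t) e = conjIdem s (conjIdem t e) :=
      Subtype.ext (by simp [conjIdem, mul_inv_rev', mul_assoc])
    simp [Finsupp.mapDomain_single, this]

/-- `K E(S)` as a left module over the semigroup algebra `K S`. -/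
noncomputable instance idemModule (K : Type*) [CommRing K] :
    Module (MonoidAlgebra K S) (Idem S →₀ K) :=
  Module.compHom _ (idemRep S K).asAlgebraHom.toRingHom

/-- The cohomology of an inverse monoid `S` with values in a left `K S`-module `V`:
`Hⁿ(S, V) = Extⁿ_{K S}(K E(S), V)`, as a `K`-vector space. -/
noncomputable def cohomology (K S V : Type u) [Field K] [InverseMonoid S] [AddCommGroup V]
    [Module (MonoidAlgebra K S) V] (n : ℕ) : ModuleCat.{u} K :=
  ((Ext K (ModuleCat.{u} (MonoidAlgebra K S)) n).obj
    (Opposite.op (ModuleCat.of (MonoidAlgebra K S) (Idem S →₀ K)))).obj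
      (ModuleCat.of (MonoidAlgebra K S) V)

end InverseMonoid

/-! ### Hochschild cohomology and separable algebras -/

/-- A `K`-algebra `A` is separable if `A` is projective as a left module over the enveloping
algebra `A ⊗ Aᵐᵒᵖ`, acting by `(a ⊗ b) · x = a x b`. -/
def IsSeparableAlgebra (K A : Type*) [CommRing K] [Ring A] [Algebra K A] : Prop :=
  letI : Module (A ⊗[K] Aᵐᵒᵖ) A := TensorProduct.Algebra.module
  Module.Projective (A ⊗[K] Aᵐᵒᵖ) A

/-- The Hochschild cohomology `Hⁿ(R, M) = Extⁿ_{Rᵉ}(R, M)` of a `K`-algebra `R` with values in an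
`R`-bimodule `M`, as a `K`-vector space. Here `Rᵉ = R ⊗ Rᵐᵒᵖ`, and a bimodule (a left `R`-module and
a left `Rᵐᵒᵖ`-module with commuting actions inducing the same action of `K`) is the left
`Rᵉ`-module with `(a ⊗ b) · x = a x b`. -/
noncomputable def hochschildCohomology (K R M : Type u) [Field K] [Ring R] [Algebra K R]
    [AddCommGroup M] [Module K M] [Module R M] [Module Rᵐᵒᵖ M] [IsScalarTower K R M]
    [IsScalarTower K Rᵐᵒᵖ M] [SMulCommClass R Rᵐᵒᵖ M] (n : ℕ) : ModuleCat.{u} K :=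
  letI : Module (R ⊗[K] Rᵐᵒᵖ) R := TensorProduct.Algebra.module
  letI : Module (R ⊗[K] Rᵐᵒᵖ) M := TensorProduct.Algebra.module
  ((Ext K (ModuleCat.{u} (R ⊗[K] Rᵐᵒᵖ)) n).obj
    (Opposite.op (ModuleCat.of (R ⊗[K] Rᵐᵒᵖ) R))).obj (ModuleCat.of (R ⊗[K] Rᵐᵒᵖ) M)

/-! ### Unital actions -/

/-- A unital action of an inverse monoid `S` on a unital `K`-algebra `A`: a homomorphism `θ` from `S`
to the symmetric inverse monoid of partial bijections of `A` with `θ 1 = id`, such that every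
`θ s` is an isomorphism of `K`-algebras onto the ideal `1_s A` generated by a central idempotent
`1_s` (`unit s`, uniquely determined as the unity of that ideal). The domain of `θ s` is then the
ideal `1_{s⁻¹} A`. -/
structure UnitalAction (K S A : Type*) [CommRing K] [InverseMonoid S] [Ring A] [Algebra K A] where
  act : S → (A ≃. A)
  act_one : act 1 = PEquiv.refl A
  act_mul : ∀ s t, act (s * t) = (act t).trans (act s)
  unit : S → A
  unit_idem : ∀ s, unit s * unit s = unit s
  unit_comm : ∀ s a, unit s * a = a * unit s
  mem_range_iff : ∀ s b, (∃ a, b ∈ act s a) ↔ ∃ c, b = unit s * c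
  map_add : ∀ s a b a' b', a' ∈ act s a → b' ∈ act s b → a' + b' ∈ act s (a + b)
  map_mul : ∀ s a b a' b', a' ∈ act s a → b' ∈ act s b → a' * b' ∈ act s (a * b)
  map_smul : ∀ s (k : K) a a', a' ∈ act s a → k • a' ∈ act s (k • a)

namespace UnitalAction

open InverseMonoid

section Basic

variable {K S A : Type*} [CommRing K] [InverseMonoid S] [Ring A] [Algebra K A]
  (θ : UnitalAction K S A)

theorem mem_range {s : S} {a b : A} (h : b ∈ θ.act s a) : θ.unit s * b = b := by
  obtain ⟨c, rfl⟩ := (θ.mem_range_iff s b).1 ⟨a, h⟩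
  rw [← mul_assoc, θ.unit_idem]

theorem mem_act_inv {s : S} {a b : A} (h : b ∈ θ.act s a) : a ∈ θ.act s⁻¹ b := by
  have h' : b ∈ θ.act (s * s⁻¹ * s) a := by rwa [mul_inv_mul]
  rw [θ.act_mul, PEquiv.mem_trans] at h'
  obtain ⟨b', hb', h'⟩ := h'
  obtain rfl : b = b' := Option.mem_unique h hb'
  rw [θ.act_mul, PEquiv.mem_trans] at h'
  obtain ⟨a', ha', h''⟩ := h'
  obtain rfl : a = a' := (θ.act s).inj h h''
  exact ha'

/-- The domain of `θ s` is `1_{s⁻¹} A`. -/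
theorem mem_dom_iff (s : S) (a : A) : (θ.act s a).isSome ↔ θ.unit s⁻¹ * a = a := by
  constructor
  · intro h
    obtain ⟨b, hb⟩ := Option.isSome_iff_exists.1 h
    exact θ.mem_range (θ.mem_act_inv hb)
  · intro h
    obtain ⟨b, hb⟩ := (θ.mem_range_iff s⁻¹ a).2 ⟨a, h.symm⟩
    have := θ.mem_act_inv hb
    rw [inv_inv'] at this
    exact Option.isSome_iff_exists.2 ⟨b, this⟩

theorem isSome_act (s : S) (a : A) : (θ.act s (θ.unit s⁻¹ * a)).isSome := by
  rw [mem_dom_iff, ← mul_assoc, θ.unit_idem]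

/-- The element `s · a = θ_s(1_{s⁻¹} a)`. -/
def app (s : S) (a : A) : A := (θ.act s (θ.unit s⁻¹ * a)).get (θ.isSome_act s a)

theorem app_mem (s : S) (a : A) : θ.app s a ∈ θ.act s (θ.unit s⁻¹ * a) := Option.get_mem _

theorem app_eq {s : S} {a b : A} (h : b ∈ θ.act s (θ.unit s⁻¹ * a)) : θ.app s a = b :=
  Option.mem_unique (θ.app_mem s a) h

theorem app_of_mem {s : S} {a b : A} (h : b ∈ θ.act s a) : θ.app s a = b := by
  refine θ.app_eq ?_
  rwa [(θ.mem_dom_iff s a).1 (Option.isSome_iff_exists.2 ⟨b, h⟩)]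

theorem unit_mul_app (s : S) (a : A) : θ.unit s * θ.app s a = θ.app s a :=
  θ.mem_range (θ.app_mem s a)

theorem app_add (s : S) (a b : A) : θ.app s (a + b) = θ.app s a + θ.app s b := by
  refine θ.app_eq ?_
  rw [mul_add]
  exact θ.map_add _ _ _ _ _ (θ.app_mem s a) (θ.app_mem s b)

theorem app_smul (s : S) (k : K) (a : A) : θ.app s (k • a) = k • θ.app s a := by
  refine θ.app_eq ?_
  rw [mul_smul_comm]
  exact θ.map_smul _ _ _ _ (θ.app_mem s a)

theorem app_mul (s : S) (a b : A) : θ.app s (a * b) = θ.app s a * θ.app s b := by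
  refine θ.app_eq ?_
  have : θ.unit s⁻¹ * (a * b) = θ.unit s⁻¹ * a * (θ.unit s⁻¹ * b) := by
    rw [mul_assoc, ← mul_assoc a, ← θ.unit_comm s⁻¹ a, mul_assoc, ← mul_assoc (θ.unit s⁻¹) (θ.unit s⁻¹),
      θ.unit_idem]
  rw [this]
  exact θ.map_mul _ _ _ _ _ (θ.app_mem s a) (θ.app_mem s b)

theorem unit_one : θ.unit 1 = 1 := by
  have h : (1 : A) ∈ θ.act 1 1 := by rw [θ.act_one]; rfl
  simpa using θ.mem_range h

theorem app_one (a : A) : θ.app 1 a = a := by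
  refine θ.app_eq ?_
  rw [θ.act_one, inv_one', unit_one, one_mul]
  rfl

theorem app_apply_one (s : S) : θ.app s 1 = θ.unit s := by
  obtain ⟨x, hx⟩ := (θ.mem_range_iff s (θ.unit s)).2 ⟨1, (mul_one _).symm⟩
  have h1 := θ.app_of_mem hx
  have h2 := θ.app_mul s 1 x
  rw [one_mul, h1, ← θ.unit_comm, unit_mul_app] at h2
  exact h2.symm

theorem app_inv_app (s : S) (a : A) : θ.app s (θ.app s⁻¹ a) = θ.unit s * a := by
  have h := θ.mem_act_inv (θ.app_mem s⁻¹ a)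
  rw [inv_inv'] at h
  exact θ.app_of_mem h

theorem app_app (s t : S) (a : A) : θ.app (s * t) a = θ.app s (θ.app t a) := by
  -- first on the unity of the domain
  have key : θ.app t (θ.unit (s * t)⁻¹) = θ.unit s⁻¹ * θ.unit t ∧
      θ.unit t⁻¹ * θ.unit (s * t)⁻¹ = θ.unit (s * t)⁻¹ := by
    obtain ⟨v, hv⟩ := (θ.mem_range_iff t (θ.unit s⁻¹ * θ.unit t)).2
      ⟨θ.unit s⁻¹, θ.unit_comm _ _⟩
    have hvdom : θ.unit (s * t)⁻¹ * v = v := by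
      rw [← mem_dom_iff, θ.act_mul]
      obtain ⟨w, hw⟩ := Option.isSome_iff_exists.1 (θ.isSome_act s (θ.unit t))
      exact Option.isSome_iff_exists.2 ⟨w, (PEquiv.mem_trans _ _ _ _).2 ⟨_, hv, hw⟩⟩
    have hu : (θ.act (s * t) (θ.unit (s * t)⁻¹)).isSome := by
      rw [mem_dom_iff, θ.unit_idem]
    obtain ⟨w, hw⟩ := Option.isSome_iff_exists.1 hu
    have hw' : w ∈ θ.act (s * t) (θ.unit (s * t)⁻¹) := hw
    rw [θ.act_mul, PEquiv.mem_trans] at hw'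
    obtain ⟨x, hx, hxw⟩ := hw'
    have hxs : θ.unit s⁻¹ * x = x := θ.mem_range (θ.mem_act_inv hxw)
    have hxt : θ.unit t * x = x := θ.mem_range hx
    have h1 := θ.map_mul t _ _ _ _ hv hx
    rw [mul_assoc, hxt, hxs] at h1
    have h2 : v * θ.unit (s * t)⁻¹ = θ.unit (s * t)⁻¹ := (θ.act t).inj h1 hx
    rw [← θ.unit_comm, hvdom] at h2
    subst h2
    exact ⟨θ.app_of_mem hv, θ.mem_range (θ.mem_act_inv hx)⟩
  obtain ⟨key, key2⟩ := key
  refine θ.app_eq ?_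
  rw [θ.act_mul, PEquiv.mem_trans]
  refine ⟨θ.unit s⁻¹ * θ.app t a, ?_, θ.app_mem s _⟩
  have h := θ.app_mem t (θ.unit (s * t)⁻¹ * a)
  rwa [app_mul, key, mul_assoc, unit_mul_app, ← mul_assoc, key2] at h

/-- The `K`-linear map `a ↦ s · a = θ_s(1_{s⁻¹} a)`. -/
def appLin (s : S) : A →ₗ[K] A where
  toFun := θ.app s
  map_add' := θ.app_add s
  map_smul' := θ.app_smul s

@[simp] theorem appLin_apply (s : S) (a : A) : θ.appLin s a = θ.app s a := rfl

/-! ### The algebra `L(A, θ, S)` -/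

/-- The map `g ↦ a δ_s · g`, with `a δ_s · b δ_t = a θ_s(1_{s⁻¹} b) δ_{st}`. -/
noncomputable def convLeft (s : S) (a : A) : (S →₀ A) →ₗ[K] (S →₀ A) :=
  Finsupp.lsum K fun t => Finsupp.lsingle (s * t) ∘ₗ LinearMap.mulLeft K a ∘ₗ θ.appLin s

@[simp] theorem convLeft_single (s t : S) (a b : A) :
    θ.convLeft s a (Finsupp.single t b) = Finsupp.single (s * t) (a * θ.app s b) := by
  rw [convLeft, Finsupp.lsum_single]
  rfl

/-- The bilinear map with `(a δ_s, b δ_t) ↦ a θ_s(1_{s⁻¹} b) δ_{st}`. -/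
noncomputable def conv : (S →₀ A) →ₗ[K] (S →₀ A) →ₗ[K] (S →₀ A) :=
  Finsupp.lsum K fun s =>
    { toFun := fun a => θ.convLeft s a
      map_add' := fun a b => by
        refine Finsupp.lhom_ext fun t c => ?_
        rw [LinearMap.add_apply]
        simp only [convLeft_single, add_mul, Finsupp.single_add]
      map_smul' := fun k a => by
        refine Finsupp.lhom_ext fun t c => ?_
        rw [LinearMap.smul_apply]
        simp only [convLeft_single, smul_mul_assoc, Finsupp.smul_single, RingHom.id_apply] }

@[simp] theorem conv_single_single (s t : S) (a b : A) :
    θ.conv (Finsupp.single s a) (Finsupp.single t b) =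
      Finsupp.single (s * t) (a * θ.app s b) := by
  rw [conv, Finsupp.lsum_single]
  exact θ.convLeft_single s t a b

theorem conv_assoc (f g h : S →₀ A) : θ.conv (θ.conv f g) h = θ.conv f (θ.conv g h) := by
  induction f using Finsupp.induction_linear with
  | zero => simp
  | add f₁ f₂ h₁ h₂ => simp [h₁, h₂]
  | single s a =>
    induction g using Finsupp.induction_linear with
    | zero => simp
    | add f₁ f₂ h₁ h₂ => simp only [_root_.map_add, LinearMap.add_apply, h₁, h₂]
    | single t b =>
      induction h using Finsupp.induction_linear with
      | zero => simp
      | add f₁ f₂ h₁ h₂ => simp only [_root_.map_add, h₁, h₂]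
      | single u c => simp only [conv_single_single, mul_assoc, app_app, app_mul]

/-- The direct sum `⨁_{s ∈ S} (1_s A) δ_s` inside `⨁_{s ∈ S} A δ_s`. -/
def sub : Submodule K (S →₀ A) where
  carrier := {f | ∀ s, θ.unit s * f s = f s}
  add_mem' hf hg s := by simp [mul_add, hf s, hg s]
  zero_mem' s := by simp
  smul_mem' k f hf s := by simp [hf s]

theorem mem_sub {f : S →₀ A} : f ∈ θ.sub ↔ ∀ s, θ.unit s * f s = f s := Iff.rfl

theorem single_mem_sub {s : S} {a : A} (h : θ.unit s * a = a) : Finsupp.single s a ∈ θ.sub := by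
  classical
  intro t
  by_cases hst : s = t
  · subst hst; simpa using h
  · simp [hst]

theorem unit_mul_conv {s t : S} {a b : A} (hb : θ.unit t * b = b) :
    θ.unit (s * t) * (a * θ.app s b) = a * θ.app s b := by
  have h : θ.unit (s * t) * θ.app s b = θ.app s b := by
    rw [← app_apply_one, app_app, ← app_mul, app_apply_one, hb]
  rw [← mul_assoc, θ.unit_comm, mul_assoc, h]

theorem conv_mem {f g : S →₀ A} (hg : g ∈ θ.sub) : θ.conv f g ∈ θ.sub := by
  induction f using Finsupp.induction_linear with
  | zero => simp
  | add f₁ f₂ h₁ h₂ => simpa using add_mem h₁ h₂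
  | single s a =>
    rw [← Finsupp.sum_single g, Finsupp.sum, map_sum]
    refine Submodule.sum_mem _ fun t _ => ?_
    rw [conv_single_single]
    exact θ.single_mem_sub (θ.unit_mul_conv (hg t))

theorem one_conv (f : S →₀ A) : θ.conv (Finsupp.single 1 1) f = f := by
  induction f using Finsupp.induction_linear with
  | zero => simp
  | add f₁ f₂ h₁ h₂ => simp [h₁, h₂]
  | single s a => simp [app_one]

theorem conv_one {f : S →₀ A} (hf : f ∈ θ.sub) : θ.conv f (Finsupp.single 1 1) = f := by
  conv_lhs => rw [← Finsupp.sum_single f, Finsupp.sum, map_sum, LinearMap.sum_apply]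
  conv_rhs => rw [← Finsupp.sum_single f, Finsupp.sum]
  refine Finset.sum_congr rfl fun s _ => ?_
  rw [conv_single_single, app_apply_one, mul_one, ← θ.unit_comm, hf s]

/-- The algebra `L(A, θ, S) = ⨁_{s ∈ S} (1_s A) δ_s` with the product
`a δ_s · b δ_t = a θ_s(1_{s⁻¹} b) δ_{st}`. -/
def L : Type _ := ↥θ.sub

noncomputable instance : AddCommGroup θ.L := inferInstanceAs (AddCommGroup ↥θ.sub)

noncomputable instance : Module K θ.L := inferInstanceAs (Module K ↥θ.sub)

/-- The inclusion of `L(A, θ, S)` into the finitely supported functions `S → A`. -/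
noncomputable def L.incl : θ.L →ₗ[K] (S →₀ A) := θ.sub.subtype

theorem L.incl_injective : Function.Injective (L.incl θ) := Subtype.val_injective

theorem L.incl_mem (x : θ.L) : L.incl θ x ∈ θ.sub := x.2

/-- The element of `L(A, θ, S)` with a given family of coefficients. -/
noncomputable def L.ofMem (f : S →₀ A) (hf : f ∈ θ.sub) : θ.L := ⟨f, hf⟩

@[simp] theorem L.incl_ofMem (f : S →₀ A) (hf : f ∈ θ.sub) : L.incl θ (L.ofMem θ f hf) = f := rfl

noncomputable instance : Mul θ.L :=
  ⟨fun x y => L.ofMem θ (θ.conv (L.incl θ x) (L.incl θ y)) (θ.conv_mem (L.incl_mem θ y))⟩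

noncomputable instance : One θ.L :=
  ⟨L.ofMem θ (Finsupp.single 1 1) (θ.single_mem_sub (by rw [unit_one, one_mul]))⟩

@[simp] theorem L.incl_mul (x y : θ.L) :
    L.incl θ (x * y) = θ.conv (L.incl θ x) (L.incl θ y) := rfl

@[simp] theorem L.incl_one : L.incl θ (1 : θ.L) = Finsupp.single 1 1 := rfl

noncomputable instance : Ring θ.L :=
  { (inferInstance : AddCommGroup θ.L), (inferInstance : Mul θ.L), (inferInstance : One θ.L) with
    left_distrib := fun x y z => L.incl_injective θ (by simp)
    right_distrib := fun x y z => L.incl_injective θ (by simp)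
    zero_mul := fun x => L.incl_injective θ (by simp)
    mul_zero := fun x => L.incl_injective θ (by simp)
    mul_assoc := fun x y z => L.incl_injective θ (by simp [conv_assoc])
    one_mul := fun x => L.incl_injective θ (by simp [one_conv])
    mul_one := fun x => L.incl_injective θ (by simp [θ.conv_one (L.incl_mem θ x)]) }

noncomputable instance : Algebra K θ.L :=
  Algebra.ofModule (fun k x y => L.incl_injective θ (by simp))
    (fun k x y => L.incl_injective θ (by simp))

/-- The element `a δ_s` of `L(A, θ, S)`, for `a ∈ 1_s A`. -/
noncomputable def δ (s : S) (a : A) (h : θ.unit s * a = a) : θ.L :=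
  L.ofMem θ (Finsupp.single s a) (θ.single_mem_sub h)

/-! ### The crossed product -/

/-- The ideal `𝓝` of `L(A, θ, S)` generated by the elements `a δ_s - a δ_t` with `a ∈ 1_s A` and
`s ≤ t`. -/
noncomputable def idealN : TwoSidedIdeal θ.L :=
  TwoSidedIdeal.span {x | ∃ (s t : S) (a : A), NatLE s t ∧ θ.unit s * a = a ∧
    L.incl θ x = Finsupp.single s a - Finsupp.single t a}

/-- The crossed product `A ⋊_θ S = L(A, θ, S) / 𝓝`. -/
def CrossedProduct : Type _ := θ.idealN.ringCon.Quotient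

noncomputable instance : Ring θ.CrossedProduct := inferInstanceAs (Ring θ.idealN.ringCon.Quotient)

noncomputable instance : Algebra K θ.CrossedProduct :=
  inferInstanceAs (Algebra K θ.idealN.ringCon.Quotient)

/-- The quotient map `L(A, θ, S) → A ⋊_θ S`. -/
noncomputable def toCrossed : θ.L →ₐ[K] θ.CrossedProduct :=
  { θ.idealN.ringCon.mk' with commutes' := fun _ => rfl }

/-- The element `1_s δ_s` of `A ⋊_θ S`. -/
noncomputable def gamma (s : S) : θ.CrossedProduct := θ.toCrossed (θ.δ s (θ.unit s) (θ.unit_idem s))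

/-- The element `a δ_1` of `A ⋊_θ S`. -/
noncomputable def ofA (a : A) : θ.CrossedProduct :=
  θ.toCrossed (θ.δ 1 a (by rw [unit_one, one_mul]))

theorem toCrossed_δ_mul {s t r : S} {a b c : A} (ha : θ.unit s * a = a) (hb : θ.unit t * b = b)
    (hc : θ.unit r * c = c) (hr : s * t = r) (h : a * θ.app s b = c) :
    θ.toCrossed (θ.δ s a ha) * θ.toCrossed (θ.δ t b hb) = θ.toCrossed (θ.δ r c hc) := by
  subst hr h
  rw [← _root_.map_mul]
  congr 1
  exact L.incl_injective θ (by simp [δ])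

theorem gamma_one : θ.gamma 1 = 1 := by
  rw [← _root_.map_one θ.toCrossed]
  exact congrArg θ.toCrossed (L.incl_injective θ (by simp [δ, unit_one]))

theorem gamma_mul (s t : S) : θ.gamma (s * t) = θ.gamma s * θ.gamma t := by
  refine (θ.toCrossed_δ_mul _ _ _ rfl ?_).symm
  rw [← app_apply_one, ← app_apply_one, ← app_apply_one, app_app, ← app_mul, one_mul]

theorem ofA_mul_gamma (s : S) (a : A) :
    θ.ofA a * θ.gamma s = θ.gamma s * θ.ofA (θ.app s⁻¹ a) := by
  have h : θ.unit s * (θ.unit s * a) = θ.unit s * a := by rw [← mul_assoc, θ.unit_idem]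
  refine (θ.toCrossed_δ_mul _ _ h (one_mul s) ?_).trans (θ.toCrossed_δ_mul _ _ h (mul_one s) ?_).symm
  · rw [app_one, θ.unit_comm]
  · rw [app_inv_app, h]

theorem gamma_inv_mul_ofA (s : S) (a : A) :
    θ.gamma s⁻¹ * θ.ofA a = θ.ofA (θ.app s⁻¹ a) * θ.gamma s⁻¹ := by
  refine (θ.toCrossed_δ_mul _ _ (θ.unit_mul_app s⁻¹ a) (mul_one _) ?_).trans
    (θ.toCrossed_δ_mul _ _ _ (one_mul _) ?_).symm
  · rw [unit_mul_app]
  · rw [app_one, ← θ.unit_comm, unit_mul_app]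

end Basic

/-! ### Modules over the semigroup algebra from bimodules over the crossed product -/

section Bimodule

variable {K S A : Type*} [CommRing K] [InverseMonoid S] [Ring A] [Algebra K A]
  (θ : UnitalAction K S A)
  (M : Type*) [AddCommGroup M] [Module K M] [Module θ.CrossedProduct M]
  [Module θ.CrossedProductᵐᵒᵖ M] [IsScalarTower K θ.CrossedProduct M]
  [IsScalarTower K θ.CrossedProductᵐᵒᵖ M] [SMulCommClass θ.CrossedProduct θ.CrossedProductᵐᵒᵖ M]

/-- The left `K S`-module structure of an `A ⋊_θ S`-bimodule:
`s · x = (1_s δ_s) x (1_{s⁻¹} δ_{s⁻¹})`. -/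
noncomputable def bimoduleRep : Representation K S M where
  toFun s :=
    { toFun := fun x => θ.gamma s • (MulOpposite.op (θ.gamma s⁻¹) • x)
      map_add' := fun x y => by simp only [smul_add]
      map_smul' := fun k x => by
        rw [RingHom.id_apply, smul_comm (MulOpposite.op (θ.gamma s⁻¹)) k x,
          smul_comm (θ.gamma s) k] }
  map_one' := by
    ext x
    simp [inv_one', gamma_one]
  map_mul' s t := by
    ext x
    simp only [LinearMap.coe_mk, AddHom.coe_mk, Module.End.mul_apply, mul_inv_rev', gamma_mul,
      MulOpposite.op_mul, mul_smul]
    rw [smul_comm (θ.gamma t) (MulOpposite.op (θ.gamma s⁻¹))]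

theorem bimoduleRep_apply (s : S) (x : M) :
    θ.bimoduleRep M s x = θ.gamma s • (MulOpposite.op (θ.gamma s⁻¹) • x) := rfl

/-- The `K`-submodule `M^A = {x | a x = x a for all a ∈ A}` of invariants, where `A` acts on both
sides through `a ↦ a δ_1`. -/
def invariants : Submodule K M where
  carrier := {x | ∀ a : A, θ.ofA a • x = MulOpposite.op (θ.ofA a) • x}
  add_mem' hx hy a := by rw [smul_add, smul_add, hx a, hy a]
  zero_mem' a := by simp
  smul_mem' k x hx a := by
    rw [smul_comm (θ.ofA a) k x, smul_comm (MulOpposite.op (θ.ofA a)) k x, hx a]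

theorem bimoduleRep_mem (s : S) {x : M} (hx : x ∈ θ.invariants M) :
    θ.bimoduleRep M s x ∈ θ.invariants M := by
  intro a
  rw [bimoduleRep_apply, smul_smul, ofA_mul_gamma, mul_smul,
    smul_comm (θ.ofA (θ.app s⁻¹ a)) (MulOpposite.op (θ.gamma s⁻¹)) x, hx (θ.app s⁻¹ a),
    smul_smul (MulOpposite.op _), ← MulOpposite.op_mul, ← gamma_inv_mul_ofA, MulOpposite.op_mul,
    mul_smul, smul_comm (θ.gamma s) (MulOpposite.op (θ.ofA a))]

/-- The left `K S`-submodule structure of `M^A`. -/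
noncomputable def invariantsRep : Representation K S (θ.invariants M) where
  toFun s := (θ.bimoduleRep M s).restrict fun _ hx => θ.bimoduleRep_mem M s hx
  map_one' := by
    ext x
    simp
  map_mul' s t := by
    ext x
    simp

/-- `M^A` as a left module over the semigroup algebra `K S`. -/
noncomputable instance invariantsModule : Module (MonoidAlgebra K S) (θ.invariants M) :=
  Module.compHom _ (θ.invariantsRep M).asAlgebraHom.toRingHom

end Bimodule

end UnitalAction

/-! ### Algebras spanned by idempotents are absolutely flat -/

/-! Write `R = A ⋊_θ S`. The functor `N ↦ N^A` from `R`-bimodules to `K S`-modules has a left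
adjoint, induction `V ↦ R ⊗_{K E(S)} V`. Here `R` is a right `K E(S)`-module through `e ↦ 1_e δ_e`,
the left action of `R` is multiplication, and on the right `(x ⊗ v) · a δ_s = x (a δ_s) ⊗ s⁻¹ v`.
The adjunction sends `f` to `v ↦ f (1 ⊗ v)`.

Three facts give the theorem. Induction is exact, because `K E(S)` is a commutative algebra spanned
by idempotents and all modules over it are flat (`Module.Flat.of_span_idempotents`,
`Induced.map_exact`). It preserves projectives, because separability of `A` makes `N ↦ N^A` preserve
surjections (`Central.map_surjective`, `projective_induced`). It sends `K E(S)` to `R`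
(`Induced.equivSelf`).

Hence a projective resolution `P` of `K E(S)` induces to a projective resolution of the bimodule
`R`, and the adjunction identifies the complexes `Hom(Ind P, M)` and `Hom(P, M^A)`, so their
cohomologies agree. -/

theorem IsLocalRing.eq_zero_or_one_of_isIdempotentElem {R : Type*} [CommRing R] [IsLocalRing R]
    {e : R} (he : IsIdempotentElem e) : e = 0 ∨ e = 1 := by
  rcases IsLocalRing.isUnit_or_isUnit_one_sub_self e with h | h
  · exact Or.inr ((IsIdempotentElem.iff_eq_one_of_isUnit h).1 he)
  · refine Or.inl (h.mul_left_cancel ?_)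
    rw [sub_mul, one_mul, he.eq, sub_self, mul_zero]

theorem Module.Flat.of_isField {R : Type*} [CommRing R] (h : IsField R) (M : Type*)
    [AddCommGroup M] [Module R M] : Module.Flat R M := by
  let := h.toField
  infer_instance

/-- Over a commutative algebra over a field that is spanned by idempotents, every module is flat. -/
theorem Module.Flat.of_span_idempotents (K : Type*) {B : Type*} [Field K] [CommRing B] [Algebra K B]
    (h : Submodule.span K {e : B | IsIdempotentElem e} = ⊤) (M : Type*) [AddCommGroup M]
    [Module B M] : Module.Flat B M := by
  refine Module.flat_of_localized_maximal M fun P _ => ?_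
  -- Idempotents become 0 or 1 in the local ring, so the image of `B`, being spanned by them,
  -- collapses to the image of `K`.
  have key : ∀ b : B, ∃ k : K, algebraMap B (Localization P.primeCompl) b =
      algebraMap K (Localization P.primeCompl) k := by
    intro b
    have hb : b ∈ Submodule.span K {e : B | IsIdempotentElem e} := h ▸ Submodule.mem_top
    induction hb using Submodule.span_induction with
    | mem e he =>
      have he' : IsIdempotentElem (algebraMap B (Localization P.primeCompl) e) :=
        IsIdempotentElem.map he _
      rcases IsLocalRing.eq_zero_or_one_of_isIdempotentElem he' with h0 | h1
      · exact ⟨0, by rw [h0, map_zero]⟩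
      · exact ⟨1, by rw [h1, map_one]⟩
    | zero => exact ⟨0, by simp⟩
    | add x y _ _ hx hy =>
      obtain ⟨k, hk⟩ := hx
      obtain ⟨l, hl⟩ := hy
      exact ⟨k + l, by rw [map_add, map_add, hk, hl]⟩
    | smul c x _ hx =>
      obtain ⟨k, hk⟩ := hx
      refine ⟨c * k, ?_⟩
      rw [Algebra.smul_def, map_mul, map_mul, hk, ← IsScalarTower.algebraMap_apply]
  -- A nonzero fraction has numerator equal to a nonzero scalar, so it is invertible.
  have hfield : IsField (Localization P.primeCompl) := by
    refine ⟨⟨0, 1, zero_ne_one⟩, mul_comm, fun {x} hx => ?_⟩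
    obtain ⟨⟨b, s⟩, hbs⟩ := IsLocalization.surj P.primeCompl x
    obtain ⟨k, hk⟩ := key b
    have hs := IsLocalization.map_units (Localization P.primeCompl) s
    have hk0 : k ≠ 0 := by
      rintro rfl
      rw [map_zero] at hk
      rw [hk] at hbs
      exact hx (hs.mul_left_eq_zero.1 hbs)
    refine ⟨algebraMap B _ s * algebraMap K _ k⁻¹, ?_⟩
    rw [← mul_assoc, hbs, hk, ← map_mul, mul_inv_cancel₀ hk0, map_one]
  -- Flat over the residual field, which is itself flat over `B` as a localization.
  have := Module.Flat.of_isField hfield (LocalizedModule P.primeCompl M)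
  exact Module.Flat.trans B (Localization P.primeCompl) _

/-! ### The commutative monoid `E(S)` and its algebra. -/

namespace InverseMonoid

variable {S : Type*} [InverseMonoid S]

noncomputable instance : CommMonoid (Idem S) where
  mul e f := ⟨e.1 * f.1, idem_mul e.2 f.2⟩
  one := ⟨1, one_mul 1⟩
  mul_assoc _ _ _ := Subtype.ext (mul_assoc _ _ _)
  one_mul _ := Subtype.ext (one_mul _)
  mul_one _ := Subtype.ext (mul_one _)
  mul_comm e f := Subtype.ext (idem_comm e.2 f.2)

@[simp] theorem Idem.coe_mul (e f : Idem S) : (e * f).1 = e.1 * f.1 := rfl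

@[simp] theorem Idem.coe_one : (1 : Idem S).1 = 1 := rfl

variable (S) in
/-- The inclusion of the idempotents. -/
def idemIncl : Idem S →* S where
  toFun := Subtype.val
  map_one' := rfl
  map_mul' _ _ := rfl

@[simp] theorem idemIncl_apply (e : Idem S) : idemIncl S e = e.1 := rfl

/-- Idempotents move across `s` at the price of conjugation, since `s s⁻¹` commutes with `e`. This
rule and the next one make the right action on the induced module well defined. -/
theorem mul_conjIdem_inv (s : S) (e : Idem S) : s * (conjIdem s⁻¹ e).1 = e.1 * s := by
  simp only [conjIdem, inv_inv']
  calc s * (s⁻¹ * e.1 * s) = s * s⁻¹ * e.1 * s := by simp [mul_assoc]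
    _ = e.1 * (s * s⁻¹ * s) := by rw [idem_comm (idem_mul_inv s) e.2]; simp [mul_assoc]
    _ = e.1 * s := by rw [mul_inv_mul]

theorem conjIdem_inv_mul_inv (s : S) (e : Idem S) : (conjIdem s⁻¹ e).1 * s⁻¹ = s⁻¹ * e.1 := by
  simp only [conjIdem, inv_inv']
  calc s⁻¹ * e.1 * s * s⁻¹ = s⁻¹ * (e.1 * (s * s⁻¹)) := by simp [mul_assoc]
    _ = s⁻¹ * s * s⁻¹ * e.1 := by rw [idem_comm e.2 (idem_mul_inv s)]; simp [mul_assoc]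
    _ = s⁻¹ * e.1 := by rw [inv_mul_inv]

/-- The algebra `K E(S)` is absolutely flat. -/
theorem flat_idemAlgebra (K : Type*) [Field K] (M : Type*) [AddCommGroup M]
    [Module (MonoidAlgebra K (Idem S)) M] : Module.Flat (MonoidAlgebra K (Idem S)) M := by
  refine Module.Flat.of_span_idempotents K (eq_top_iff.2 fun x _ => ?_) M
  induction x using MonoidAlgebra.induction_linear with
  | zero => exact zero_mem _
  | add x y hx hy => exact add_mem (hx trivial) (hy trivial)
  | single e k =>
    have : MonoidAlgebra.single e k = k • MonoidAlgebra.single e (1 : K) := by simp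
    rw [this]
    refine Submodule.smul_mem _ _ (Submodule.subset_span ?_)
    change MonoidAlgebra.single e (1 : K) * MonoidAlgebra.single e 1 = MonoidAlgebra.single e 1
    rw [MonoidAlgebra.single_mul_single, one_mul]
    congr 1
    exact Subtype.ext e.2

end InverseMonoid

/-! ### Calculus in the crossed product. -/

namespace UnitalAction

open InverseMonoid

section Crossed

variable {K S A : Type*} [CommRing K] [InverseMonoid S] [Ring A] [Algebra K A]
  (θ : UnitalAction K S A)

theorem toCrossed_eq_iff {x y : θ.L} :
    θ.toCrossed x = θ.toCrossed y ↔ x - y ∈ θ.idealN :=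
  (RingCon.eq θ.idealN.ringCon).trans (θ.idealN.rel_iff x y)

theorem toCrossed_surjective : Function.Surjective θ.toCrossed :=
  RingCon.mk'_surjective _

theorem toCrossed_eq_of_natLE {s t : S} {a : A} (hst : NatLE s t) (hs : θ.unit s * a = a)
    (ht : θ.unit t * a = a) : θ.toCrossed (θ.δ s a hs) = θ.toCrossed (θ.δ t a ht) := by
  rw [toCrossed_eq_iff]
  exact TwoSidedIdeal.subset_span ⟨s, t, a, hst, hs, by simp [δ]⟩

/-- Since `e ≤ 1`, the relations defining the quotient identify `1_e δ_e` with `1_e δ_1`. Thus `γ_e`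
lies in the image of `A`, where it is central; the adjunction rests on this. -/
theorem gamma_idem (e : Idem S) : θ.gamma e.1 = θ.ofA (θ.unit e.1) :=
  θ.toCrossed_eq_of_natLE ⟨e.1, e.2, (mul_one _).symm⟩ _ _

/-- The homomorphism `a ↦ a δ_1` from `A` to `A ⋊_θ S`. -/
noncomputable def ofAHom : A →ₐ[K] θ.CrossedProduct :=
  AlgHom.ofLinearMap
    (θ.toCrossed.toLinearMap ∘ₗ
      { toFun := fun a => θ.δ 1 a (by rw [unit_one, one_mul])
        map_add' := fun a b => L.incl_injective θ (by simp [δ])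
        map_smul' := fun k a => L.incl_injective θ (by simp [δ]) })
    (by rw [← _root_.map_one θ.toCrossed]; rfl)
    (fun a b => by
      have h : ∀ c : A, θ.unit 1 * c = c := fun c => by rw [unit_one, one_mul]
      exact (θ.toCrossed_δ_mul (h a) (h b) (h _) (one_mul 1) (by rw [app_one])).symm)

@[simp] theorem ofAHom_apply (a : A) : θ.ofAHom a = θ.ofA a := rfl

theorem toCrossed_δ (s : S) (a : A) (h : θ.unit s * a = a) :
    θ.toCrossed (θ.δ s a h) = θ.ofA a * θ.gamma s := by
  refine (θ.toCrossed_δ_mul _ _ h (one_mul s) ?_).symm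
  rw [app_one, ← θ.unit_comm, h]

theorem gamma_mul_ofA (s : S) (a : A) :
    θ.gamma s * θ.ofA a = θ.ofA (θ.app s a) * θ.gamma s := by
  simpa only [inv_inv'] using θ.gamma_inv_mul_ofA s⁻¹ a

theorem gamma_idem_comm (e : Idem S) (a : A) :
    θ.gamma e.1 * θ.ofA a = θ.ofA a * θ.gamma e.1 := by
  rw [gamma_idem, ← ofAHom_apply, ← ofAHom_apply, ← _root_.map_mul, ← _root_.map_mul, θ.unit_comm]

theorem ofA_mul_gamma_idem (e : Idem S) {a : A} (h : θ.unit e.1 * a = a) :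
    θ.ofA a * θ.gamma e.1 = θ.ofA a := by
  rw [gamma_idem, ← ofAHom_apply, ← ofAHom_apply, ← _root_.map_mul, ← θ.unit_comm, h]

theorem L.induction {p : θ.L → Prop} (zero : p 0) (add : ∀ x y, p x → p y → p (x + y))
    (single : ∀ s a h, p (θ.δ s a h)) (x : θ.L) : p x := by
  have hx : x = ∑ s ∈ (L.incl θ x).support, θ.δ s (L.incl θ x s) (L.incl_mem θ x s) := by
    refine L.incl_injective θ ?_
    conv_lhs => rw [← Finsupp.sum_single (L.incl θ x), Finsupp.sum]
    rw [map_sum]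
    rfl
  rw [hx]
  exact Finset.sum_induction _ p add zero fun s _ => single _ _ _

/-- The classes of `a δ_s` generate the crossed product additively, and each factors as `(a δ_1)
γ_s`. -/
theorem CrossedProduct.induction {p : θ.CrossedProduct → Prop} (zero : p 0)
    (add : ∀ x y, p x → p y → p (x + y)) (mul : ∀ s a, θ.unit s * a = a → p (θ.ofA a * θ.gamma s))
    (x : θ.CrossedProduct) : p x := by
  obtain ⟨x, rfl⟩ := θ.toCrossed_surjective x
  induction x using L.induction with
  | zero => simpa using zero
  | add x y hx hy => simpa using add _ _ hx hy
  | single s a h => rw [toCrossed_δ]; exact mul s a h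

end Crossed

end UnitalAction

/-! ### The induced bimodule. -/

namespace UnitalAction

open InverseMonoid

section Induced

variable {K S A : Type*} [CommRing K] [InverseMonoid S] [Ring A] [Algebra K A]
  (θ : UnitalAction K S A)

/-- `A ⋊_θ S` as a module over `K E(S)`, by right multiplication. -/
noncomputable instance crossedIdemModule : Module (MonoidAlgebra K (Idem S)) θ.CrossedProduct :=
  Module.compHom _ (MonoidAlgebra.lift K θ.CrossedProductᵐᵒᵖ (Idem S)
    { toFun := fun e => MulOpposite.op (θ.gamma e.1)
      map_one' := by rw [Idem.coe_one, gamma_one, MulOpposite.op_one]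
      -- Right multiplication reverses products; this is harmless because idempotents commute.
      map_mul' := fun e f => by
        rw [mul_comm, Idem.coe_mul, gamma_mul, MulOpposite.op_mul] }).toRingHom

theorem single_smul_crossed (e : Idem S) (k : K) (x : θ.CrossedProduct) :
    MonoidAlgebra.single e k • x = k • (x * θ.gamma e.1) := by
  change MonoidAlgebra.lift K θ.CrossedProductᵐᵒᵖ (Idem S) _ (MonoidAlgebra.single e k) • x = _
  rw [MonoidAlgebra.lift_single]
  change (k • MulOpposite.op (θ.gamma e.1)) • x = _
  rw [smul_assoc]
  rfl

/-- Left and right multiplications commute, so the tensor product over `K E(S)` inherits a left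
module structure over the crossed product. -/
instance : SMulCommClass (MonoidAlgebra K (Idem S)) θ.CrossedProduct θ.CrossedProduct :=
  ⟨fun b x y => by
    induction b using MonoidAlgebra.induction_linear with
    | zero => simp
    | add b c hb hc => rw [add_smul, hb, hc, add_smul, smul_add]
    | single e k =>
      rw [single_smul_crossed, single_smul_crossed, smul_eq_mul, smul_eq_mul, mul_smul_comm,
        mul_assoc]⟩

instance : SMulCommClass (MonoidAlgebra K (Idem S)) K θ.CrossedProduct :=
  ⟨fun b x y => by
    induction b using MonoidAlgebra.induction_linear with
    | zero => simp
    | add b c hb hc => rw [add_smul, hb, hc, add_smul, smul_add]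
    | single e k =>
      rw [single_smul_crossed, single_smul_crossed, smul_mul_assoc, smul_comm]⟩

variable (V : Type*) [AddCommGroup V] [Module (MonoidAlgebra K S) V]

/-- A `K S`-module as a module over `K E(S)`. -/
@[reducible] noncomputable def idemModuleOfModule : Module (MonoidAlgebra K (Idem S)) V :=
  Module.compHom _ (MonoidAlgebra.lift K (MonoidAlgebra K S) (Idem S)
    ((MonoidAlgebra.of K S).comp (idemIncl S))).toRingHom

attribute [local instance] idemModuleOfModule

theorem single_smul_eq (e : Idem S) (k : K) (v : V) :
    MonoidAlgebra.single e k • v = MonoidAlgebra.single e.1 k • v := by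
  change MonoidAlgebra.lift K (MonoidAlgebra K S) (Idem S) _ (MonoidAlgebra.single e k) • v = _
  rw [MonoidAlgebra.lift_single]
  simp

/-- The tensor product `(A ⋊_θ S) ⊗_{K E(S)} V`. -/
def Induced : Type _ := θ.CrossedProduct ⊗[MonoidAlgebra K (Idem S)] V

noncomputable instance : AddCommGroup (θ.Induced V) :=
  inferInstanceAs (AddCommGroup (θ.CrossedProduct ⊗[MonoidAlgebra K (Idem S)] V))

noncomputable instance : Module θ.CrossedProduct (θ.Induced V) :=
  inferInstanceAs (Module θ.CrossedProduct (θ.CrossedProduct ⊗[MonoidAlgebra K (Idem S)] V))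

noncomputable instance : Module K (θ.Induced V) :=
  inferInstanceAs (Module K (θ.CrossedProduct ⊗[MonoidAlgebra K (Idem S)] V))

instance : IsScalarTower K θ.CrossedProduct (θ.Induced V) :=
  inferInstanceAs
    (IsScalarTower K θ.CrossedProduct (θ.CrossedProduct ⊗[MonoidAlgebra K (Idem S)] V))

variable {V}

/-- The pure tensors of `(A ⋊_θ S) ⊗_{K E(S)} V`. -/
noncomputable def Induced.tmul (x : θ.CrossedProduct) (v : V) : θ.Induced V :=
  x ⊗ₜ[MonoidAlgebra K (Idem S)] v

namespace Induced

theorem add_tmul (x y : θ.CrossedProduct) (v : V) : tmul θ (x + y) v = tmul θ x v + tmul θ y v :=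
  TensorProduct.add_tmul x y v

theorem tmul_add (x : θ.CrossedProduct) (v w : V) : tmul θ x (v + w) = tmul θ x v + tmul θ x w :=
  TensorProduct.tmul_add x v w

theorem zero_tmul (v : V) : tmul θ 0 v = 0 := TensorProduct.zero_tmul _ _

theorem tmul_zero (x : θ.CrossedProduct) : tmul θ x (0 : V) = 0 := TensorProduct.tmul_zero _ _

theorem smul_tmul (x y : θ.CrossedProduct) (v : V) : x • tmul θ y v = tmul θ (x * y) v := rfl

theorem smul_tmul' (k : K) (y : θ.CrossedProduct) (v : V) :
    k • tmul θ y v = tmul θ (k • y) v := rfl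

theorem mul_gamma_tmul (e : Idem S) (x : θ.CrossedProduct) (v : V) :
    tmul θ (x * θ.gamma e.1) v = tmul θ x (MonoidAlgebra.single e.1 (1 : K) • v) := by
  have := TensorProduct.smul_tmul (R := MonoidAlgebra K (Idem S))
    (MonoidAlgebra.single e (1 : K)) x v
  rwa [single_smul_crossed, one_smul, single_smul_eq] at this

/-- `V` carries only a `K S`-module structure, so a scalar `k` acts on it as `k · 1 ∈ K S`. -/
theorem smul_tmul_eq (k : K) (x : θ.CrossedProduct) (v : V) :
    tmul θ (k • x) v = tmul θ x (MonoidAlgebra.single (1 : S) k • v) := by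
  have := TensorProduct.smul_tmul (R := MonoidAlgebra K (Idem S))
    (MonoidAlgebra.single (1 : Idem S) k) x v
  rwa [single_smul_crossed, single_smul_eq, Idem.coe_one, gamma_one, mul_one] at this

@[elab_as_elim]
theorem induction_on {p : θ.Induced V → Prop} (w : θ.Induced V) (zero : p 0)
    (tmul : ∀ x v, p (tmul θ x v)) (add : ∀ x y, p x → p y → p (x + y)) : p w :=
  TensorProduct.induction_on w zero tmul add

/-- Balanced biadditive maps induce additive maps on `(A ⋊_θ S) ⊗_{K E(S)} V`. -/
noncomputable def lift {P : Type*} [AddCommGroup P] (f : θ.CrossedProduct →+ V →+ P)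
    (hk : ∀ (k : K) x v, f (k • x) v = f x (MonoidAlgebra.single (1 : S) k • v))
    (he : ∀ (e : Idem S) x v, f (x * θ.gamma e.1) v = f x (MonoidAlgebra.single e.1 (1 : K) • v)) :
    θ.Induced V →+ P :=
  -- Each basis term `k e` of `K E(S)` is a product of a scalar and an idempotent, so balancing over
  -- these two kinds suffices.
  TensorProduct.liftAddHom f fun b x v => by
    induction b using MonoidAlgebra.induction_linear with
    | zero => simp
    | add b c hb hc => rw [add_smul, _root_.map_add, AddMonoidHom.add_apply, hb, hc, add_smul, _root_.map_add]
    | single e k =>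
      rw [single_smul_crossed, single_smul_eq, hk, he, ← mul_smul,
        MonoidAlgebra.single_mul_single, mul_one, one_mul]

theorem single_smul_single_smul (s : S) (v : V) (k l : K) (t : S) :
    MonoidAlgebra.single s k • MonoidAlgebra.single t l • v =
      MonoidAlgebra.single (s * t) (k * l) • v := by
  rw [← mul_smul, MonoidAlgebra.single_mul_single]

theorem ofA_mul_gamma_conj (s : S) (a : A) (e : Idem S) :
    θ.ofA a * θ.gamma s * θ.gamma (conjIdem s⁻¹ e).1 = θ.gamma e.1 * (θ.ofA a * θ.gamma s) := by
  rw [mul_assoc, ← gamma_mul, mul_conjIdem_inv, gamma_mul, ← mul_assoc, ← gamma_idem_comm,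
    mul_assoc]

/-- The additive map `x ⊗ v ↦ x (a δ_s) ⊗ s⁻¹ v`. -/
noncomputable def rightAddHom (s : S) (a : A) : θ.Induced V →+ θ.Induced V :=
  lift θ
    { toFun := fun x =>
        { toFun := fun v =>
            tmul θ (x * (θ.ofA a * θ.gamma s)) (MonoidAlgebra.single s⁻¹ (1 : K) • v)
          map_zero' := by rw [smul_zero, tmul_zero]
          map_add' := fun v w => by rw [smul_add, tmul_add] }
      map_zero' := AddMonoidHom.ext fun v =>
        (congrArg (tmul θ · _) (zero_mul _)).trans (zero_tmul θ _)
      map_add' := fun x y => AddMonoidHom.ext fun v =>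
        (congrArg (tmul θ · _) (add_mul x y _)).trans (add_tmul θ _ _ _) }
    (fun k x v => by
      change tmul θ _ _ = tmul θ _ _
      rw [smul_mul_assoc, smul_tmul_eq, single_smul_single_smul,
        single_smul_single_smul, mul_comm k, one_mul, mul_one])
    (fun e x v => by
      change tmul θ _ _ = tmul θ _ _
      -- Pushing `γ_e` to the right past `a δ_s` turns it into the idempotent `s⁻¹ e s`, which
      -- crosses the tensor sign, and `(s⁻¹ e s) s⁻¹ = s⁻¹ e`.
      rw [mul_assoc x, ← ofA_mul_gamma_conj, ← mul_assoc x, mul_gamma_tmul,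
        single_smul_single_smul, single_smul_single_smul, conjIdem_inv_mul_inv])

theorem rightAddHom_tmul (s : S) (a : A) (x : θ.CrossedProduct) (v : V) :
    rightAddHom θ s a (tmul θ x v) =
      tmul θ (x * (θ.ofA a * θ.gamma s)) (MonoidAlgebra.single s⁻¹ (1 : K) • v) := rfl

/-- The right action of `a δ_s`: `x ⊗ v ↦ x (a δ_s) ⊗ s⁻¹ v`. -/
noncomputable def rightAct (s : S) (a : A) : Module.End K (θ.Induced V) where
  toFun := rightAddHom θ s a
  map_add' := _root_.map_add _
  map_smul' k w := by
    induction w using induction_on with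
    | zero => rw [smul_zero, map_zero, smul_zero]
    | tmul x v =>
      rw [smul_tmul', rightAddHom_tmul, rightAddHom_tmul, smul_mul_assoc]
      rfl
    | add x y hx hy => rw [smul_add, _root_.map_add, hx, hy, _root_.map_add, smul_add]

theorem rightAct_tmul (s : S) (a : A) (x : θ.CrossedProduct) (v : V) :
    rightAct θ s a (tmul θ x v) =
      tmul θ (x * (θ.ofA a * θ.gamma s)) (MonoidAlgebra.single s⁻¹ (1 : K) • v) := rfl

theorem end_ext {f g : Module.End K (θ.Induced V)} (h : ∀ x v, f (tmul θ x v) = g (tmul θ x v)) :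
    f = g := by
  ext w
  induction w using induction_on with
  | zero => simp
  | tmul x v => exact h x v
  | add x y hx hy => rw [_root_.map_add, _root_.map_add, hx, hy]

variable (V) in
/-- The right action of finitely supported functions. -/
noncomputable def rightActLin : (S →₀ A) →ₗ[K] Module.End K (θ.Induced V) :=
  Finsupp.lsum K fun s =>
    { toFun := rightAct θ s
      map_add' := fun a b => end_ext θ fun x v => by
        rw [LinearMap.add_apply, rightAct_tmul, rightAct_tmul, rightAct_tmul, ← add_tmul, ← mul_add,
          ← add_mul, ← ofAHom_apply, _root_.map_add]
        rfl
      map_smul' := fun k a => end_ext θ fun x v => by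
        rw [RingHom.id_apply, LinearMap.smul_apply, rightAct_tmul, rightAct_tmul, smul_tmul',
          ← ofAHom_apply, _root_.map_smul, smul_mul_assoc, mul_smul_comm]
        rfl }

theorem rightActLin_single (s : S) (a : A) :
    rightActLin θ V (Finsupp.single s a) = rightAct θ s a := by
  rw [rightActLin, Finsupp.lsum_single]
  rfl

/-- The order is reversed because the action is on the right. On generators it comes down to `γ_s b
= θ_s(b) γ_s` and `(s t)⁻¹ = t⁻¹ s⁻¹`. -/
theorem rightActLin_conv (f g : S →₀ A) :
    rightActLin θ V (θ.conv f g) = rightActLin θ V g * rightActLin θ V f := by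
  induction f using Finsupp.induction_linear with
  | zero => simp
  | add f₁ f₂ h₁ h₂ => simp [h₁, h₂, mul_add]
  | single s a =>
    induction g using Finsupp.induction_linear with
    | zero => simp
    | add f₁ f₂ h₁ h₂ => simp [h₁, h₂, add_mul]
    | single t b =>
      rw [conv_single_single, rightActLin_single, rightActLin_single, rightActLin_single]
      refine end_ext θ fun x v => ?_
      rw [Module.End.mul_apply, rightAct_tmul, rightAct_tmul, rightAct_tmul,
        single_smul_single_smul, one_mul, mul_inv_rev', gamma_mul]
      congr 1
      rw [← ofAHom_apply, _root_.map_mul, ofAHom_apply, ofAHom_apply]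
      simp only [mul_assoc]
      rw [← mul_assoc (θ.gamma s), gamma_mul_ofA, mul_assoc]

/-- This is what lets the action of `L` descend to the crossed product. If `s = e t`, then `a ∈ 1_e
A` gives `a γ_e = a`, so `a γ_s = a γ_t`, and `a γ_t` absorbs `f = t⁻¹ e t` on its right. Moving `f`
across the tensor sign removes the difference between `s⁻¹ = t⁻¹ e = f t⁻¹` and `t⁻¹`, as `f` is
idempotent. -/
theorem rightAct_eq_of_natLE {s t : S} {a : A} (hst : NatLE s t) (ha : θ.unit s * a = a) :
    (rightAct θ s a : Module.End K (θ.Induced V)) = rightAct θ t a := by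
  obtain ⟨e, he, rfl⟩ := hst
  have hu : θ.unit e * θ.unit (e * t) = θ.unit (e * t) := by
    rw [← θ.app_apply_one (e * t), app_app, unit_mul_app]
  have hea : θ.unit e * a = a := by rw [← ha, ← mul_assoc, hu]
  have hg : θ.ofA a * θ.gamma e = θ.ofA a := θ.ofA_mul_gamma_idem ⟨e, he⟩ hea
  have hg' : θ.ofA a * θ.gamma (e * t) = θ.ofA a * θ.gamma t := by
    rw [gamma_mul, ← mul_assoc, hg]
  refine end_ext θ fun x v => ?_
  have hc := ofA_mul_gamma_conj θ t a ⟨e, he⟩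
  rw [← mul_assoc, gamma_idem_comm θ ⟨e, he⟩, hg] at hc
  rw [rightAct_tmul, rightAct_tmul, hg', ← hc, ← mul_assoc x, mul_gamma_tmul, mul_gamma_tmul,
    single_smul_single_smul, single_smul_single_smul, mul_inv_rev', inv_of_idem he,
    conjIdem_inv_mul_inv, mul_one, ← conjIdem_inv_mul_inv t ⟨e, he⟩, ← mul_assoc]
  congr 3
  exact (mul_assoc _ _ _).symm.trans <| congrArg (· * t⁻¹) (conjIdem t⁻¹ ⟨e, he⟩).2

variable (V) in
/-- The right action of `L(A, θ, S)`. -/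
noncomputable def rightActL : θ.L →ₐ[K] (Module.End K (θ.Induced V))ᵐᵒᵖ :=
  AlgHom.ofLinearMap
    ((MulOpposite.opLinearEquiv K).toLinearMap ∘ₗ rightActLin θ V ∘ₗ L.incl θ)
    (by
      refine MulOpposite.unop_injective ?_
      change rightActLin θ V (Finsupp.single 1 1) = 1
      rw [rightActLin_single]
      refine end_ext θ fun x v => ?_
      rw [rightAct_tmul, gamma_one, inv_one', ← ofAHom_apply, map_one, mul_one, mul_one,
        ← MonoidAlgebra.one_def, one_smul]
      rfl)
    (fun x y => by
      refine MulOpposite.unop_injective ?_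
      change rightActLin θ V (θ.conv (L.incl θ x) (L.incl θ y)) = _
      rw [rightActLin_conv]
      rfl)

theorem ringCon_le_ker_rightActL : θ.idealN.ringCon ≤ RingCon.ker (rightActL θ V).toRingHom := by
  have h : θ.idealN ≤ TwoSidedIdeal.ker (rightActL θ V) := by
    refine TwoSidedIdeal.span_le.2 ?_
    rintro x ⟨s, t, a, hst, ha, hx⟩
    rw [SetLike.mem_coe, TwoSidedIdeal.mem_ker]
    refine MulOpposite.unop_injective ?_
    change rightActLin θ V (L.incl θ x) = 0
    rw [hx, map_sub, rightActLin_single, rightActLin_single, rightAct_eq_of_natLE θ hst ha, sub_self]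
  intro x y hxy
  have := h ((θ.idealN.rel_iff x y).1 hxy)
  rw [TwoSidedIdeal.mem_ker, map_sub, sub_eq_zero] at this
  exact this

variable (V) in
/-- The right action of `A ⋊_θ S`. -/
noncomputable def rightActHom : θ.CrossedProduct →ₐ[K] (Module.End K (θ.Induced V))ᵐᵒᵖ :=
  RingCon.liftₐ θ.idealN.ringCon (rightActL θ V) (ringCon_le_ker_rightActL θ)

theorem rightActHom_apply (s : S) (a : A) (h : θ.unit s * a = a) :
    rightActHom θ V (θ.ofA a * θ.gamma s) = MulOpposite.op (rightAct θ s a) := by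
  rw [← toCrossed_δ θ s a h]
  change MulOpposite.op (rightActLin θ V (Finsupp.single s a)) = _
  rw [rightActLin_single]

variable (V) in
/-- The action of the enveloping algebra of `A ⋊_θ S`. -/
noncomputable def envAct :
    (θ.CrossedProduct ⊗[K] θ.CrossedProductᵐᵒᵖ) →ₐ[K] Module.End K (θ.Induced V) :=
  Algebra.TensorProduct.lift (Algebra.lsmul K K (θ.Induced V))
    (AlgHom.opComm (rightActHom θ V)) (by
      intro x y
      induction y using MulOpposite.rec' with | _ y
      change Algebra.lsmul K K (θ.Induced V) x * (rightActHom θ V y).unop =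
        (rightActHom θ V y).unop * Algebra.lsmul K K (θ.Induced V) x
      induction y using CrossedProduct.induction with
      | zero => simp
      | add y z hy hz => rw [_root_.map_add, MulOpposite.unop_add, mul_add, hy, hz, add_mul]
      | mul s a h =>
        rw [rightActHom_apply θ s a h]
        refine end_ext θ fun z v => ?_
        change x • rightAct θ s a (tmul θ z v) = rightAct θ s a (x • tmul θ z v)
        rw [rightAct_tmul, smul_tmul, smul_tmul, rightAct_tmul, mul_assoc])

noncomputable instance : Module (θ.CrossedProduct ⊗[K] θ.CrossedProductᵐᵒᵖ) (θ.Induced V) :=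
  Module.compHom _ (envAct θ V).toRingHom

theorem tmul_op_smul_tmul (x : θ.CrossedProduct) (s : S) (a : A) (h : θ.unit s * a = a)
    (y : θ.CrossedProduct) (v : V) :
    (x ⊗ₜ[K] MulOpposite.op (θ.ofA a * θ.gamma s)) • tmul θ y v =
      tmul θ (x * y * (θ.ofA a * θ.gamma s)) (MonoidAlgebra.single s⁻¹ (1 : K) • v) := by
  change envAct θ V _ (tmul θ y v) = _
  rw [envAct, Algebra.TensorProduct.lift_tmul]
  change x • (rightActHom θ V (θ.ofA a * θ.gamma s)).unop (tmul θ y v) = _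
  rw [rightActHom_apply θ s a h, MulOpposite.unop_op, rightAct_tmul, smul_tmul, mul_assoc]

theorem tmul_one_smul_tmul (x y : θ.CrossedProduct) (v : V) :
    (x ⊗ₜ[K] (1 : θ.CrossedProductᵐᵒᵖ)) • tmul θ y v = tmul θ (x * y) v := by
  change envAct θ V _ (tmul θ y v) = _
  rw [envAct, Algebra.TensorProduct.lift_tmul, map_one, mul_one]
  rfl

end Induced

end Induced

end UnitalAction

/-! ### The adjunction with `A`-invariants, and separability. -/

namespace UnitalAction

open InverseMonoid

section Adjunction

variable {K S A : Type*} [CommRing K] [InverseMonoid S] [Ring A] [Algebra K A]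
  (θ : UnitalAction K S A)

theorem unit_mul_inv_self (s : S) : θ.unit (s * s⁻¹) = θ.unit s := by
  rw [← app_apply_one, app_app, app_inv_app, mul_one]

/-- The enveloping algebra of `A ⋊_θ S`. -/
abbrev Env : Type _ := θ.CrossedProduct ⊗[K] θ.CrossedProductᵐᵒᵖ

theorem env_zero_smul {N : Type*} [AddCommGroup N] [Module θ.Env N] (x : N) :
    (0 : θ.Env) • x = 0 := zero_smul θ.Env x

/-- The homomorphism `s ↦ γ_s ⊗ γ_{s⁻¹}` from `K S` to the enveloping algebra. -/
noncomputable def conjHom : MonoidAlgebra K S →ₐ[K] θ.Env :=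
  MonoidAlgebra.lift K θ.Env S
    { toFun := fun s => θ.gamma s ⊗ₜ MulOpposite.op (θ.gamma s⁻¹)
      map_one' := by rw [inv_one', gamma_one]; rfl
      map_mul' := fun s t => by
        rw [mul_inv_rev', gamma_mul, gamma_mul, MulOpposite.op_mul,
          Algebra.TensorProduct.tmul_mul_tmul] }

theorem conjHom_single (s : S) (k : K) :
    θ.conjHom (MonoidAlgebra.single s k) = k • (θ.gamma s ⊗ₜ MulOpposite.op (θ.gamma s⁻¹)) :=
  MonoidAlgebra.lift_single _ _ _

variable (N : Type*) [AddCommGroup N] [Module θ.Env N]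

/-- The `K S`-module structure `s · x = γ_s x γ_{s⁻¹}`. -/
@[reducible] noncomputable def conjModule : Module (MonoidAlgebra K S) N :=
  Module.compHom N θ.conjHom.toRingHom

/-- The element `a` passes `γ_s` as `θ_{s⁻¹}(1_s a)`, commutes with `x` in that form, and turns back
into `a` on passing `γ_{s⁻¹}`. -/
theorem conj_comm {N : Type*} [AddCommGroup N] [Module θ.Env N] {x : N}
    (hx : ∀ a : A, (θ.ofA a ⊗ₜ[K] (1 : θ.CrossedProductᵐᵒᵖ)) • x =
      ((1 : θ.CrossedProduct) ⊗ₜ[K] MulOpposite.op (θ.ofA a)) • x) (s : S) (a : A) :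
    (θ.ofA a ⊗ₜ[K] (1 : θ.CrossedProductᵐᵒᵖ)) •
        (θ.gamma s ⊗ₜ[K] MulOpposite.op (θ.gamma s⁻¹)) • x =
      ((1 : θ.CrossedProduct) ⊗ₜ[K] MulOpposite.op (θ.ofA a)) •
        (θ.gamma s ⊗ₜ[K] MulOpposite.op (θ.gamma s⁻¹)) • x := by
  have h1 : (θ.ofA a ⊗ₜ[K] (1 : θ.CrossedProductᵐᵒᵖ)) *
      (θ.gamma s ⊗ₜ[K] MulOpposite.op (θ.gamma s⁻¹)) =
      (θ.gamma s ⊗ₜ[K] MulOpposite.op (θ.gamma s⁻¹)) *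
        (θ.ofA (θ.app s⁻¹ a) ⊗ₜ[K] (1 : θ.CrossedProductᵐᵒᵖ)) := by
    rw [Algebra.TensorProduct.tmul_mul_tmul, Algebra.TensorProduct.tmul_mul_tmul, one_mul, mul_one,
      ofA_mul_gamma]
  have h2 : (θ.gamma s ⊗ₜ[K] MulOpposite.op (θ.gamma s⁻¹)) *
      ((1 : θ.CrossedProduct) ⊗ₜ[K] MulOpposite.op (θ.ofA (θ.app s⁻¹ a))) =
      ((1 : θ.CrossedProduct) ⊗ₜ[K] MulOpposite.op (θ.ofA a)) *
        (θ.gamma s ⊗ₜ[K] MulOpposite.op (θ.gamma s⁻¹)) := by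
    rw [Algebra.TensorProduct.tmul_mul_tmul, Algebra.TensorProduct.tmul_mul_tmul, one_mul, mul_one,
      ← MulOpposite.op_mul, ← MulOpposite.op_mul, gamma_inv_mul_ofA]
  rw [← mul_smul, h1, mul_smul, hx, ← mul_smul, h2, mul_smul]

/-- The elements of an `A ⋊_θ S`-bimodule that commute with `A`, as a `K S`-submodule. -/
noncomputable def central : @Submodule (MonoidAlgebra K S) N _ _ (θ.conjModule N) :=
  letI := θ.conjModule N
  { carrier := {x | ∀ a : A, (θ.ofA a ⊗ₜ[K] (1 : θ.CrossedProductᵐᵒᵖ)) • x =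
      ((1 : θ.CrossedProduct) ⊗ₜ[K] MulOpposite.op (θ.ofA a)) • x}
    add_mem' := fun hx hy a => by rw [smul_add, smul_add, hx a, hy a]
    zero_mem' := fun a => by rw [smul_zero, smul_zero]
    smul_mem' := fun b x hx a => by
      change _ • θ.conjHom b • x = _ • θ.conjHom b • x
      induction b using MonoidAlgebra.induction_linear with
      | zero =>
        have h : θ.conjHom 0 • x = 0 := by rw [map_zero]; exact env_zero_smul θ x
        rw [h, smul_zero, smul_zero]
      | add b c hb hc => rw [_root_.map_add, add_smul, smul_add, smul_add, hb, hc]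
      | single s k =>
        rw [conjHom_single, ← smul_one_mul k, mul_smul, ← Algebra.algebraMap_eq_smul_one,
          ← mul_smul, ← Algebra.commutes, mul_smul, conj_comm θ hx, ← mul_smul, ← mul_smul,
          Algebra.commutes, mul_smul, mul_smul] }

/-- The `K S`-module of elements that commute with `A`. -/
def Central : Type _ := ↥(θ.central N)

noncomputable instance : AddCommGroup (θ.Central N) :=
  letI := θ.conjModule N
  inferInstanceAs (AddCommGroup ↥(θ.central N))

noncomputable instance : Module (MonoidAlgebra K S) (θ.Central N) :=
  letI := θ.conjModule N
  inferInstanceAs (Module (MonoidAlgebra K S) ↥(θ.central N))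

variable {N}

namespace Central

/-- The inclusion of the elements that commute with `A`. -/
def val : θ.Central N →+ N where
  toFun := Subtype.val
  map_zero' := rfl
  map_add' _ _ := rfl

theorem val_injective : Function.Injective (val θ : θ.Central N → N) := Subtype.val_injective

theorem val_smul (b : MonoidAlgebra K S) (x : θ.Central N) :
    val θ (b • x) = θ.conjHom b • val θ x := rfl

theorem val_comm (x : θ.Central N) (a : A) :
    (θ.ofA a ⊗ₜ[K] (1 : θ.CrossedProductᵐᵒᵖ)) • val θ x =
      ((1 : θ.CrossedProduct) ⊗ₜ[K] MulOpposite.op (θ.ofA a)) • val θ x := x.2 a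

/-- The element with given underlying element. -/
def mk (x : N) (hx : ∀ a : A, (θ.ofA a ⊗ₜ[K] (1 : θ.CrossedProductᵐᵒᵖ)) • x =
    ((1 : θ.CrossedProduct) ⊗ₜ[K] MulOpposite.op (θ.ofA a)) • x) : θ.Central N := ⟨x, hx⟩

@[simp] theorem val_mk (x : N) (hx) : val θ (mk θ x hx) = x := rfl

/-- The map induced by a bimodule homomorphism. -/
noncomputable def map {N' : Type*} [AddCommGroup N'] [Module θ.Env N'] (p : N →ₗ[θ.Env] N') :
    θ.Central N →ₗ[MonoidAlgebra K S] θ.Central N' where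
  toFun x := mk θ (p (val θ x)) fun a => by rw [← p.map_smul, val_comm, p.map_smul]
  map_add' x y := val_injective θ (by simp)
  map_smul' b x := val_injective θ (by simp [val_smul])

theorem val_map {N' : Type*} [AddCommGroup N'] [Module θ.Env N'] (p : N →ₗ[θ.Env] N')
    (x : θ.Central N) : val θ (map θ p x) = p (val θ x) := rfl

/-- If `A` is separable, then taking the elements that commute with `A` is exact. -/
theorem map_surjective (hA : IsSeparableAlgebra K A) {N' : Type*} [AddCommGroup N']
    [Module θ.Env N'] (p : N →ₗ[θ.Env] N') (hp : Function.Surjective p) :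
    Function.Surjective (map θ p) := by
  intro y
  -- Restriction along `i` turns bimodules over the crossed product into `A`-bimodules.
  let i : A ⊗[K] Aᵐᵒᵖ →ₐ[K] θ.Env := Algebra.TensorProduct.map θ.ofAHom (AlgHom.op θ.ofAHom)
  have hi : ∀ a b : A, i (a ⊗ₜ MulOpposite.op b) = θ.ofA a ⊗ₜ MulOpposite.op (θ.ofA b) :=
    fun a b => rfl
  let _ : Module (A ⊗[K] Aᵐᵒᵖ) A := TensorProduct.Algebra.module
  let _ : Module (A ⊗[K] Aᵐᵒᵖ) N := Module.compHom N i.toRingHom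
  let _ : Module (A ⊗[K] Aᵐᵒᵖ) N' := Module.compHom N' i.toRingHom
  have hN : ∀ (c : A ⊗[K] Aᵐᵒᵖ) (n : N), c • n = i c • n := fun _ _ => rfl
  have hN' : ∀ (c : A ⊗[K] Aᵐᵒᵖ) (n : N'), c • n = i c • n := fun _ _ => rfl
  have : Module.Projective (A ⊗[K] Aᵐᵒᵖ) A := hA
  let p' : N →ₗ[A ⊗[K] Aᵐᵒᵖ] N' :=
    { toFun := p
      map_add' := _root_.map_add p
      map_smul' := fun c n => p.map_smul (i c) n }
  -- The map `a ↦ a y` is a bimodule map exactly because `y` commutes with `A`. Projectivity of `A`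
  -- lifts it through `p`.
  let g : A →ₗ[A ⊗[K] Aᵐᵒᵖ] N' :=
    { toFun := fun a => (θ.ofA a ⊗ₜ[K] (1 : θ.CrossedProductᵐᵒᵖ)) • val θ y
      map_add' := fun a b => by
        rw [← ofAHom_apply, _root_.map_add, TensorProduct.add_tmul, add_smul]
        rfl
      map_smul' := fun c a => by
        rw [RingHom.id_apply]
        induction c using TensorProduct.induction_on with
        | zero =>
          have h : (θ.ofA 0 ⊗ₜ[K] (1 : θ.CrossedProductᵐᵒᵖ)) • val θ y = 0 := by
            rw [← ofAHom_apply, map_zero, TensorProduct.zero_tmul]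
            exact env_zero_smul θ _
          have h' : (0 : A ⊗[K] Aᵐᵒᵖ) • a = 0 := zero_smul (A ⊗[K] Aᵐᵒᵖ) a
          have h'' : (0 : A ⊗[K] Aᵐᵒᵖ) • (θ.ofA a ⊗ₜ[K] (1 : θ.CrossedProductᵐᵒᵖ)) • val θ y = 0 :=
            zero_smul (A ⊗[K] Aᵐᵒᵖ) ((θ.ofA a ⊗ₜ[K] (1 : θ.CrossedProductᵐᵒᵖ)) • val θ y)
          exact ((congrArg (fun c => (θ.ofA c ⊗ₜ[K] (1 : θ.CrossedProductᵐᵒᵖ)) • val θ y) h').trans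
            h).trans h''.symm
        | add c d hc hd =>
          rw [add_smul, add_smul, ← hc, ← hd, ← ofAHom_apply, _root_.map_add,
            TensorProduct.add_tmul, add_smul]
          rfl
        | tmul b c =>
          induction c using MulOpposite.rec' with | _ c
          rw [hN', hi, TensorProduct.Algebra.smul_def, smul_eq_mul, op_smul_eq_mul,
            ← mul_smul, Algebra.TensorProduct.tmul_mul_tmul, mul_one,
            ← mul_one (θ.ofA b * θ.ofA a), ← one_mul (MulOpposite.op (θ.ofA c)),
            ← Algebra.TensorProduct.tmul_mul_tmul, mul_smul, ← val_comm, ← mul_smul,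
            Algebra.TensorProduct.tmul_mul_tmul, mul_one, ← ofAHom_apply, ← ofAHom_apply,
            ← ofAHom_apply, ← ofAHom_apply, ← _root_.map_mul, ← _root_.map_mul, mul_assoc] }
  obtain ⟨h, hh⟩ := Module.projective_lifting_property p' g hp
  have h1 : ∀ a : A, (a ⊗ₜ[K] (1 : Aᵐᵒᵖ)) • (1 : A) = a := fun a => by
    rw [TensorProduct.Algebra.smul_def, one_smul, smul_eq_mul, mul_one]
  have h2 : ∀ a : A, ((1 : A) ⊗ₜ[K] MulOpposite.op a) • (1 : A) = a := fun a => by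
    rw [TensorProduct.Algebra.smul_def, one_smul, op_smul_eq_mul, one_mul]
  -- The lift sends `1` to a preimage of `y`; it commutes with `A` because `a · 1 = 1 · a` in `A`.
  refine ⟨mk θ (h 1) fun a => ?_, val_injective θ ?_⟩
  · have := congrArg h ((h1 a).trans (h2 a).symm)
    rw [h.map_smul, h.map_smul, hN, hN, ← MulOpposite.op_one, hi, hi] at this
    simpa [← ofAHom_apply, map_one] using this
  · rw [val_map, val_mk]
    have := LinearMap.congr_fun hh 1
    refine this.trans ?_
    change (θ.ofA 1 ⊗ₜ[K] (1 : θ.CrossedProductᵐᵒᵖ)) • val θ y = val θ y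
    rw [← ofAHom_apply, map_one, ← Algebra.TensorProduct.one_def, one_smul]

end Central

variable {V : Type*} [AddCommGroup V] [Module (MonoidAlgebra K S) V]

namespace Induced

theorem addHom_ext {P : Type*} [AddCommGroup P] {f g : θ.Induced V →+ P}
    (h : ∀ x v, f (tmul θ x v) = g (tmul θ x v)) : f = g := by
  ext w
  induction w using induction_on with
  | zero => simp
  | tmul x v => exact h x v
  | add x y hx hy => rw [_root_.map_add, _root_.map_add, hx, hy]

theorem linearMap_ext {f g : θ.Induced V →ₗ[θ.Env] N}
    (h : ∀ x v, f (tmul θ x v) = g (tmul θ x v)) : f = g :=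
  LinearMap.toAddMonoidHom_injective (addHom_ext θ h)

/-- An additive map that is compatible with the action on pure tensors is a bimodule
homomorphism. -/
noncomputable def envLinear (f : θ.Induced V →+ N)
    (h : ∀ x s a y v, θ.unit s * a = a →
      f (tmul θ (x * y * (θ.ofA a * θ.gamma s)) (MonoidAlgebra.single s⁻¹ (1 : K) • v)) =
        (x ⊗ₜ[K] MulOpposite.op (θ.ofA a * θ.gamma s)) • f (tmul θ y v)) :
    θ.Induced V →ₗ[θ.Env] N where
  toFun := f
  map_add' := _root_.map_add f
  map_smul' c w := by
    rw [RingHom.id_apply]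
    induction c using TensorProduct.induction_on with
    | zero =>
      exact (congrArg f (env_zero_smul θ w)).trans
          ((map_zero f).trans (env_zero_smul θ (f w)).symm)
    | add c d hc hd => rw [add_smul, add_smul, _root_.map_add, hc, hd]
    | tmul x z =>
      induction z using MulOpposite.rec' with | _ z
      induction z using CrossedProduct.induction with
      | zero =>
        rw [MulOpposite.op_zero, TensorProduct.tmul_zero]
        exact (congrArg f (env_zero_smul θ w)).trans
          ((map_zero f).trans (env_zero_smul θ (f w)).symm)
      | add y z hy hz =>
        rw [MulOpposite.op_add, TensorProduct.tmul_add, add_smul, add_smul, _root_.map_add, hy, hz]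
      | mul s a hs =>
        induction w using induction_on with
        | zero => rw [smul_zero, map_zero, smul_zero]
        | add w w' hw hw' => rw [smul_add, _root_.map_add, hw, hw', _root_.map_add, smul_add]
        | tmul y v => rw [tmul_op_smul_tmul θ x s a hs, h x s a y v hs]

theorem one_tmul_op_ofA_smul (a : A) (y : θ.CrossedProduct) (v : V) :
    ((1 : θ.CrossedProduct) ⊗ₜ[K] MulOpposite.op (θ.ofA a)) • tmul θ y v =
      tmul θ (y * θ.ofA a) v := by
  have := tmul_op_smul_tmul θ 1 1 a (by rw [unit_one, one_mul]) y v
  rwa [gamma_one, mul_one, one_mul, inv_one', ← MonoidAlgebra.one_def, one_smul] at this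

theorem unit_mul_gamma (s : S) : θ.ofA (θ.unit s) * θ.gamma s = θ.gamma s :=
  (θ.toCrossed_δ s (θ.unit s) (θ.unit_idem s)).symm

theorem gamma_tmul_op_gamma_smul (s : S) (y : θ.CrossedProduct) (v : V) :
    (θ.gamma s ⊗ₜ[K] MulOpposite.op (θ.gamma s⁻¹)) • tmul θ y v =
      tmul θ (θ.gamma s * y * θ.gamma s⁻¹) (MonoidAlgebra.single s (1 : K) • v) := by
  have := tmul_op_smul_tmul θ (θ.gamma s) s⁻¹ (θ.unit s⁻¹) (θ.unit_idem _) y v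
  rwa [unit_mul_gamma, inv_inv'] at this

/-- Conjugation by `s` gives `γ_s γ_{s⁻¹} ⊗ s v`. The factor `γ_{s s⁻¹}` crosses the tensor sign and
is absorbed, since `s s⁻¹ s = s`. This makes the unit of the adjunction `K S`-linear. -/
theorem conjHom_smul_one_tmul (b : MonoidAlgebra K S) (v : V) :
    θ.conjHom b • tmul θ 1 v = tmul θ 1 (b • v) := by
  induction b using MonoidAlgebra.induction_linear with
  | zero =>
    rw [map_zero, zero_smul (MonoidAlgebra K S) v, tmul_zero]
    exact env_zero_smul θ _
  | add b c hb hc => rw [_root_.map_add, add_smul, add_smul, tmul_add, hb, hc]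
  | single s k =>
    have h : (k • (θ.gamma s ⊗ₜ[K] MulOpposite.op (θ.gamma s⁻¹)) : θ.Env) =
        ((k • (1 : θ.CrossedProduct)) ⊗ₜ[K] (1 : θ.CrossedProductᵐᵒᵖ)) *
          (θ.gamma s ⊗ₜ[K] MulOpposite.op (θ.gamma s⁻¹)) := by
      rw [Algebra.TensorProduct.tmul_mul_tmul, one_mul, smul_mul_assoc, one_mul,
        TensorProduct.smul_tmul']
    have hs := mul_gamma_tmul θ ⟨s * s⁻¹, idem_mul_inv s⟩ 1 (MonoidAlgebra.single s k • v)
    rw [single_smul_single_smul, mul_inv_mul, one_mul, one_mul] at hs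
    rw [conjHom_single, h, mul_smul, gamma_tmul_op_gamma_smul, tmul_one_smul_tmul, mul_one,
      smul_mul_assoc, one_mul, smul_tmul_eq, single_smul_single_smul, one_mul, mul_one,
      ← gamma_mul, hs]

/-- The `K S`-linear map `v ↦ f (1 ⊗ v)`. -/
noncomputable def toCentral (f : θ.Induced V →ₗ[θ.Env] N) :
    V →ₗ[MonoidAlgebra K S] θ.Central N where
  toFun v := Central.mk θ (f (tmul θ 1 v)) fun a => by
    rw [← f.map_smul, tmul_one_smul_tmul, ← f.map_smul, one_tmul_op_ofA_smul, mul_one, one_mul]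
  map_add' v w := Central.val_injective θ (by simp [tmul_add])
  map_smul' b v := Central.val_injective θ (by
    rw [RingHom.id_apply, Central.val_smul, Central.val_mk, Central.val_mk, ← f.map_smul,
      conjHom_smul_one_tmul])

theorem val_toCentral (f : θ.Induced V →ₗ[θ.Env] N) (v : V) :
    Central.val θ (toCentral θ f v) = f (tmul θ 1 v) := rfl

/-- The bimodule homomorphism `x ⊗ v ↦ x g(v)`. -/
noncomputable def ofCentral (g : V →ₗ[MonoidAlgebra K S] θ.Central N) :
    θ.Induced V →ₗ[θ.Env] N :=
  envLinear θ
    (lift θ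
      { toFun := fun x =>
          { toFun := fun v => (x ⊗ₜ[K] (1 : θ.CrossedProductᵐᵒᵖ)) • Central.val θ (g v)
            map_zero' := by simp
            map_add' := fun v w => by simp }
        map_zero' := by
          ext v
          change ((0 : θ.CrossedProduct) ⊗ₜ[K] (1 : θ.CrossedProductᵐᵒᵖ)) • Central.val θ (g v) = 0
          rw [TensorProduct.zero_tmul]
          exact env_zero_smul θ _
        map_add' := fun x y => by ext v; simp [TensorProduct.add_tmul, add_smul] }
      (fun k x v => by
        change (_ : θ.Env) • Central.val θ (g v) = (_ : θ.Env) • Central.val θ (g _)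
        rw [g.map_smul, Central.val_smul, conjHom_single, inv_one', gamma_one, MulOpposite.op_one,
          ← mul_smul, mul_smul_comm, Algebra.TensorProduct.tmul_mul_tmul, mul_one, mul_one,
          TensorProduct.smul_tmul'])
      -- Balancing over `e`: as `γ_e` comes from `A` it commutes with `g(v)`, so `γ_e g(v) γ_e = γ_e
      -- g(v)`.
      (fun e x v => by
        change (_ : θ.Env) • Central.val θ (g v) = (_ : θ.Env) • Central.val θ (g _)
        have h : (θ.gamma e.1 ⊗ₜ[K] MulOpposite.op (θ.gamma e.1)) • Central.val θ (g v) =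
            (θ.gamma e.1 ⊗ₜ[K] (1 : θ.CrossedProductᵐᵒᵖ)) • Central.val θ (g v) := by
          have h1 : θ.gamma e.1 ⊗ₜ[K] MulOpposite.op (θ.gamma e.1) =
              (θ.gamma e.1 ⊗ₜ[K] (1 : θ.CrossedProductᵐᵒᵖ)) *
                ((1 : θ.CrossedProduct) ⊗ₜ[K] MulOpposite.op (θ.gamma e.1)) := by
            rw [Algebra.TensorProduct.tmul_mul_tmul, one_mul, mul_one]
          have h2 : θ.gamma e.1 * θ.gamma e.1 = θ.gamma e.1 := by rw [← gamma_mul, e.2.eq]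
          rw [h1, mul_smul, gamma_idem, ← Central.val_comm, ← gamma_idem, ← mul_smul,
            Algebra.TensorProduct.tmul_mul_tmul, one_mul, h2]
        rw [g.map_smul, Central.val_smul, conjHom_single, one_smul, inv_of_idem e.2, h, ← mul_smul,
          Algebra.TensorProduct.tmul_mul_tmul, mul_one]))
    -- Right linearity: `a γ_s · γ_{s⁻¹} g(v) γ_s = a g(v) γ_s = g(v) a γ_s`, using `a γ_{s s⁻¹} =
    -- a` for `a ∈ 1_s A`.
    (fun x s a y v hs => by
      change (_ : θ.Env) • Central.val θ (g _) =
        (_ : θ.Env) • (y ⊗ₜ[K] (1 : θ.CrossedProductᵐᵒᵖ)) • Central.val θ (g v)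
      have h1 : θ.ofA a * (θ.gamma s * θ.gamma s⁻¹) = θ.ofA a := by
        rw [← gamma_mul]
        exact ofA_mul_gamma_idem θ ⟨_, idem_mul_inv s⟩ (by rw [unit_mul_inv_self, hs])
      have h2 : (x * y) ⊗ₜ[K] MulOpposite.op (θ.ofA a * θ.gamma s) =
          ((x * y) ⊗ₜ[K] MulOpposite.op (θ.gamma s)) *
            ((1 : θ.CrossedProduct) ⊗ₜ[K] MulOpposite.op (θ.ofA a)) := by
        rw [Algebra.TensorProduct.tmul_mul_tmul, mul_one, MulOpposite.op_mul]
      rw [g.map_smul, Central.val_smul, conjHom_single, one_smul, inv_inv', ← mul_smul, ← mul_smul,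
        Algebra.TensorProduct.tmul_mul_tmul, Algebra.TensorProduct.tmul_mul_tmul, mul_one, one_mul,
        h2, mul_smul _ _ (Central.val θ (g v)), ← Central.val_comm, ← mul_smul,
        Algebra.TensorProduct.tmul_mul_tmul, mul_one, mul_assoc (x * y), mul_assoc (θ.ofA a), h1])

theorem ofCentral_tmul (g : V →ₗ[MonoidAlgebra K S] θ.Central N) (x : θ.CrossedProduct) (v : V) :
    ofCentral θ g (tmul θ x v) =
      (x ⊗ₜ[K] (1 : θ.CrossedProductᵐᵒᵖ)) • Central.val θ (g v) := rfl

theorem toCentral_ofCentral (g : V →ₗ[MonoidAlgebra K S] θ.Central N) :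
    toCentral θ (ofCentral θ g) = g := by
  ext v
  refine Central.val_injective θ ?_
  rw [val_toCentral, ofCentral_tmul, ← Algebra.TensorProduct.one_def, one_smul]

theorem ofCentral_toCentral (f : θ.Induced V →ₗ[θ.Env] N) :
    ofCentral θ (toCentral θ f) = f := by
  refine linearMap_ext θ fun x v => ?_
  rw [ofCentral_tmul, val_toCentral, ← f.map_smul, tmul_one_smul_tmul, mul_one]

end Induced

end Adjunction

/-- If `A` is separable, then induction preserves projective modules. -/
theorem projective_induced {K S A : Type u} [CommRing K] [InverseMonoid S] [Ring A] [Algebra K A]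
    (θ : UnitalAction K S A) (hA : IsSeparableAlgebra K A) (V : Type u) [AddCommGroup V]
    [Module (MonoidAlgebra K S) V] [Module.Projective (MonoidAlgebra K S) V] :
    Module.Projective θ.Env (θ.Induced V) := by
  refine Module.Projective.of_lifting_property fun p f hp => ?_
  -- The lifting problem is transposed to `K S`-modules, where separability keeps the map
  -- surjective.
  obtain ⟨h, hh⟩ := Module.projective_lifting_property (Central.map θ p)
    (Induced.toCentral θ f) (Central.map_surjective θ hA p hp)
  refine ⟨Induced.ofCentral θ h, Induced.linearMap_ext θ fun x v => ?_⟩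
  have hv := congrArg (Central.val θ) (LinearMap.congr_fun hh v)
  rw [LinearMap.comp_apply, Central.val_map, Induced.val_toCentral] at hv
  rw [LinearMap.comp_apply, Induced.ofCentral_tmul, p.map_smul, hv, ← f.map_smul,
    Induced.tmul_one_smul_tmul, mul_one]

end UnitalAction

/-! ### Inducing `K E(S)` gives the crossed product. -/

namespace UnitalAction

open InverseMonoid

section IdemModule

variable {K S A : Type*} [CommRing K] [InverseMonoid S] [Ring A] [Algebra K A]
  (θ : UnitalAction K S A)

theorem single_smul_idemModule (s : S) (k l : K) (e : Idem S) :
    (MonoidAlgebra.single s k : MonoidAlgebra K S) • (Finsupp.single e l : Idem S →₀ K) =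
      Finsupp.single (conjIdem s e) (k * l) := by
  change (idemRep S K).asAlgebraHom (MonoidAlgebra.single s k) _ = _
  rw [Representation.asAlgebraHom_single, LinearMap.smul_apply]
  change k • Finsupp.mapDomain _ _ = _
  rw [Finsupp.mapDomain_single, Finsupp.smul_single, smul_eq_mul]

/-- The linear map `e ↦ γ_e` from `K E(S)` to `A ⋊_θ S`. -/
noncomputable def gammaIdem : (Idem S →₀ K) →ₗ[K] θ.CrossedProduct :=
  Finsupp.linearCombination K fun e => θ.gamma e.1

theorem gammaIdem_single (e : Idem S) (k : K) :
    θ.gammaIdem (Finsupp.single e k) = k • θ.gamma e.1 :=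
  Finsupp.linearCombination_single _ _ _

theorem gammaIdem_single_smul (e : Idem S) (k : K) (f : Idem S →₀ K) :
    θ.gammaIdem (MonoidAlgebra.single e.1 k • f) = k • (θ.gamma e.1 * θ.gammaIdem f) := by
  induction f using Finsupp.induction_linear with
  | zero => simp
  | add f g hf hg => rw [smul_add, _root_.map_add, hf, hg, _root_.map_add, mul_add, smul_add]
  | single f l =>
    have h : conjIdem e.1 f = e * f := Subtype.ext (by
      change e.1 * f.1 * e.1⁻¹ = e.1 * f.1
      rw [inv_of_idem e.2, idem_comm e.2 f.2, mul_assoc, e.2.eq])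
    rw [single_smul_idemModule, gammaIdem_single, gammaIdem_single, h, Idem.coe_mul, gamma_mul,
      mul_smul_comm, smul_smul]

/-- On a basis element this is `s (s⁻¹ e s) = e s`. Together with `gammaIdem_comm` it makes `x ⊗ e ↦
x γ_e` linear on the right. -/
theorem gamma_mul_gammaIdem (s : S) (f : Idem S →₀ K) :
    θ.gamma s * θ.gammaIdem (MonoidAlgebra.single s⁻¹ (1 : K) • f) =
      θ.gammaIdem f * θ.gamma s := by
  induction f using Finsupp.induction_linear with
  | zero => simp
  | add f g hf hg => rw [smul_add, _root_.map_add, mul_add, hf, hg, _root_.map_add, add_mul]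
  | single e k =>
    rw [single_smul_idemModule, gammaIdem_single, gammaIdem_single, mul_smul_comm, smul_mul_assoc,
      ← gamma_mul, ← gamma_mul, mul_conjIdem_inv, one_mul]

theorem gammaIdem_comm (f : Idem S →₀ K) (a : A) :
    θ.gammaIdem f * θ.ofA a = θ.ofA a * θ.gammaIdem f := by
  induction f using Finsupp.induction_linear with
  | zero => simp
  | add f g hf hg => rw [_root_.map_add, add_mul, hf, hg, mul_add]
  | single e k => rw [gammaIdem_single, smul_mul_assoc, gamma_idem_comm, mul_smul_comm]

/-- `A ⋊_θ S` as a module over its enveloping algebra. -/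
@[reducible] noncomputable def envModuleSelf : Module θ.Env θ.CrossedProduct :=
  TensorProduct.Algebra.module

attribute [local instance] envModuleSelf

namespace Induced

/-- The bimodule homomorphism `x ⊗ e ↦ x γ_e`. -/
noncomputable def toSelf : θ.Induced (Idem S →₀ K) →ₗ[θ.Env] θ.CrossedProduct :=
  envLinear θ
    (lift θ
      { toFun := fun x =>
          { toFun := fun f => x * θ.gammaIdem f
            map_zero' := by simp
            map_add' := fun f g => by rw [_root_.map_add, mul_add] }
        map_zero' := by ext f; simp
        map_add' := fun x y => by ext f; simp [add_mul] }
      (fun k x f => by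
        change k • x * θ.gammaIdem f = x * θ.gammaIdem _
        have := θ.gammaIdem_single_smul 1 k f
        rw [Idem.coe_one, gamma_one, one_mul] at this
        rw [this, smul_mul_assoc, mul_smul_comm])
      (fun e x f => by
        change x * θ.gamma e.1 * θ.gammaIdem f = x * θ.gammaIdem _
        rw [gammaIdem_single_smul, one_smul, mul_assoc]))
    (fun x s a y f _ => by
      change x * y * (θ.ofA a * θ.gamma s) * θ.gammaIdem _ = x * (y * θ.gammaIdem f * _)
      rw [mul_assoc (x * y), mul_assoc (θ.ofA a), gamma_mul_gammaIdem, ← mul_assoc (θ.ofA a),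
        ← gammaIdem_comm]
      simp only [mul_assoc, MulOpposite.unop_op])

theorem toSelf_tmul (x : θ.CrossedProduct) (f : Idem S →₀ K) :
    toSelf θ (tmul θ x f) = x * θ.gammaIdem f := rfl

theorem toSelf_tmul_one (x : θ.CrossedProduct) :
    toSelf θ (tmul θ x (Finsupp.single 1 1)) = x := by
  rw [toSelf_tmul, gammaIdem_single, one_smul, Idem.coe_one, gamma_one, mul_one]

/-- `K E(S)` is generated over itself by the basis element `1`, so every tensor can be written as `y
⊗ 1`; hence `x ↦ x ⊗ 1` inverts `toSelf`. -/
theorem mul_gammaIdem_tmul_one (x : θ.CrossedProduct) (f : Idem S →₀ K) :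
    tmul θ (x * θ.gammaIdem f) (Finsupp.single 1 1 : Idem S →₀ K) = tmul θ x f := by
  induction f using Finsupp.induction_linear with
  | zero => rw [map_zero, mul_zero, zero_tmul, tmul_zero]
  | add f g hf hg => rw [_root_.map_add, mul_add, add_tmul, hf, hg, tmul_add]
  | single e k =>
    rw [gammaIdem_single, mul_smul_comm, smul_tmul_eq, mul_gamma_tmul, single_smul_single_smul,
      single_smul_idemModule]
    congr 2
    · refine Subtype.ext ?_
      simp [conjIdem, inv_of_idem e.2, e.2.eq]
    · simp

/-- `(A ⋊_θ S) ⊗_{K E(S)} K E(S)` is `A ⋊_θ S`. -/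
noncomputable def equivSelf : θ.Induced (Idem S →₀ K) ≃ₗ[θ.Env] θ.CrossedProduct :=
  LinearEquiv.ofBijective (toSelf θ) (by
    have h : ∀ w, tmul θ (toSelf θ w) (Finsupp.single 1 1 : Idem S →₀ K) = w := fun w => by
      induction w using induction_on with
      | zero => rw [map_zero, zero_tmul]
      | tmul x f => rw [toSelf_tmul, mul_gammaIdem_tmul_one]
      | add x y hx hy => rw [_root_.map_add, add_tmul, hx, hy]
    exact ⟨Function.LeftInverse.injective (g := fun x => tmul θ x (Finsupp.single 1 1)) h,
      fun x => ⟨_, toSelf_tmul_one θ x⟩⟩)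

section Map

variable {V V' : Type*} [AddCommGroup V] [Module (MonoidAlgebra K S) V]
  [AddCommGroup V'] [Module (MonoidAlgebra K S) V']

/-- The functoriality of induction. -/
noncomputable def map (f : V →ₗ[MonoidAlgebra K S] V') : θ.Induced V →ₗ[θ.Env] θ.Induced V' :=
  ofCentral θ (toCentral θ LinearMap.id ∘ₗ f)

@[simp] theorem map_tmul (f : V →ₗ[MonoidAlgebra K S] V') (x : θ.CrossedProduct) (v : V) :
    map θ f (tmul θ x v) = tmul θ x (f v) := by
  rw [map, ofCentral_tmul, LinearMap.comp_apply, val_toCentral, LinearMap.id_apply,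
    tmul_one_smul_tmul, mul_one]

end Map

end Induced

end IdemModule

/-! ### Exactness of induction and the induction functor. -/

namespace Induced

section Exact

variable {K S A : Type*} [Field K] [InverseMonoid S] [Ring A] [Algebra K A]
  (θ : UnitalAction K S A) {V V' V'' : Type*} [AddCommGroup V] [Module (MonoidAlgebra K S) V]
  [AddCommGroup V'] [Module (MonoidAlgebra K S) V'] [AddCommGroup V'']
  [Module (MonoidAlgebra K S) V'']

attribute [local instance] idemModuleOfModule

/-- A `K S`-linear map as a `K E(S)`-linear map. -/
noncomputable def idemLinear (f : V →ₗ[MonoidAlgebra K S] V') : V →ₗ[MonoidAlgebra K (Idem S)] V' where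
  toFun := f
  map_add' := _root_.map_add f
  map_smul' b v := f.map_smul (MonoidAlgebra.lift K (MonoidAlgebra K S) (Idem S)
    ((MonoidAlgebra.of K S).comp (idemIncl S)) b) v

/-- Exactness depends only on the underlying functions, so this reduces it to flatness over `K
E(S)`. -/
theorem map_eq_lTensor (f : V →ₗ[MonoidAlgebra K S] V') :
    (map θ f : θ.Induced V → θ.Induced V') = (idemLinear f).lTensor θ.CrossedProduct := by
  have : (map θ f).toAddMonoidHom =
      ((idemLinear f).lTensor θ.CrossedProduct).toAddMonoidHom :=
    addHom_ext θ fun x v => map_tmul θ f x v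
  exact congrArg DFunLike.coe this

/-- Induction is exact. -/
theorem map_exact {f : V →ₗ[MonoidAlgebra K S] V'} {g : V' →ₗ[MonoidAlgebra K S] V''}
    (h : Function.Exact f g) : Function.Exact (map θ f) (map θ g) := by
  have := flat_idemAlgebra (S := S) K θ.CrossedProduct
  rw [map_eq_lTensor, map_eq_lTensor]
  exact Module.Flat.lTensor_exact (f := idemLinear f) (g := idemLinear g) θ.CrossedProduct h

end Exact

end Induced

open CategoryTheory

section Functor

variable {K S A : Type u} [Field K] [InverseMonoid S] [Ring A] [Algebra K A]
  (θ : UnitalAction K S A)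

/-- Induction as a functor. -/
noncomputable def inducedFunctor :
    ModuleCat.{u} (MonoidAlgebra K S) ⥤ ModuleCat.{u} θ.Env where
  obj V := ModuleCat.of θ.Env (θ.Induced V)
  map f := ModuleCat.ofHom (Induced.map θ f.hom)
  map_id V := ModuleCat.hom_ext (Induced.linearMap_ext θ fun x v => Induced.map_tmul θ _ x v)
  map_comp f g := ModuleCat.hom_ext (Induced.linearMap_ext θ fun x v => by
    rw [ModuleCat.hom_ofHom, Induced.map_tmul, ModuleCat.hom_comp, LinearMap.comp_apply,
      ModuleCat.hom_comp, LinearMap.comp_apply, ModuleCat.hom_ofHom, ModuleCat.hom_ofHom,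
      Induced.map_tmul, Induced.map_tmul])

instance : θ.inducedFunctor.Additive where
  map_add {V W f g} := ModuleCat.hom_ext (Induced.linearMap_ext θ fun x v => by
    change Induced.map θ (f + g).hom (Induced.tmul θ x v) =
      Induced.map θ f.hom (Induced.tmul θ x v) + Induced.map θ g.hom (Induced.tmul θ x v)
    rw [Induced.map_tmul, Induced.map_tmul, Induced.map_tmul, ModuleCat.hom_add,
      LinearMap.add_apply, Induced.tmul_add])

/-- For an additive functor of abelian categories it is enough to preserve exact three-term
complexes. -/
instance : θ.inducedFunctor.PreservesHomology :=
  ((Functor.exact_tfae θ.inducedFunctor).out 1 2).1 fun X hX => by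
    rw [ShortComplex.ShortExact.moduleCat_exact_iff_function_exact] at hX ⊢
    exact Induced.map_exact θ hX

theorem preservesProjectiveObjects_inducedFunctor (hA : IsSeparableAlgebra K A) :
    θ.inducedFunctor.PreservesProjectiveObjects where
  projective_obj {V} hV := by
    have : Module.Projective (MonoidAlgebra K S) V := (IsProjective.iff_projective _).2 hV
    exact (IsProjective.iff_projective _).1 (θ.projective_induced hA V)

end Functor

end UnitalAction

/-! ### Comparison of the two cohomologies. -/

open CategoryTheory InverseMonoid

namespace UnitalAction

section Comparison

variable {K S A : Type u} [Field K] [InverseMonoid S] [Ring A] [Algebra K A]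
  (θ : UnitalAction K S A)
  (M : Type u) [AddCommGroup M] [Module K M] [Module θ.CrossedProduct M]
  [Module θ.CrossedProductᵐᵒᵖ M] [IsScalarTower K θ.CrossedProduct M]
  [IsScalarTower K θ.CrossedProductᵐᵒᵖ M] [SMulCommClass θ.CrossedProduct θ.CrossedProductᵐᵒᵖ M]

/-- A bimodule as a module over the enveloping algebra. -/
@[reducible] noncomputable def envModule : Module θ.Env M := TensorProduct.Algebra.module

attribute [local instance] envModule

/-- The two descriptions of `M^A` agree. -/
noncomputable def invariantsEquiv : θ.invariants M ≃ₗ[MonoidAlgebra K S] θ.Central M where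
  toFun x := Central.mk θ x.1 fun a => by
    rw [TensorProduct.Algebra.smul_def, TensorProduct.Algebra.smul_def, one_smul, one_smul]
    exact x.2 a
  invFun x := ⟨Central.val θ x, fun a => by
    have := Central.val_comm θ x a
    rwa [TensorProduct.Algebra.smul_def, TensorProduct.Algebra.smul_def, one_smul, one_smul]
      at this⟩
  left_inv _ := rfl
  right_inv _ := rfl
  map_add' _ _ := rfl
  map_smul' b x := Central.val_injective θ (by
    rw [RingHom.id_apply, Central.val_smul, Central.val_mk, Central.val_mk]
    induction b using MonoidAlgebra.induction_linear with
    | zero =>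
      rw [map_zero, zero_smul]
      exact (env_zero_smul θ _).symm
    | add b c hb hc =>
      rw [_root_.map_add, add_smul, add_smul, Submodule.coe_add, hb, hc]
    | single s k =>
      rw [conjHom_single, TensorProduct.smul_tmul', TensorProduct.Algebra.smul_def, smul_assoc]
      change ((θ.invariantsRep M).asAlgebraHom (MonoidAlgebra.single s k) x).1 = _
      rw [Representation.asAlgebraHom_single]
      rfl)

/-- The adjunction isomorphism between bimodule homomorphisms and `K S`-linear maps. -/
noncomputable def inducedHomEquiv (V : ModuleCat.{u} (MonoidAlgebra K S)) :
    (θ.inducedFunctor.obj V ⟶ ModuleCat.of θ.Env M) ≃ₗ[K]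
      (V ⟶ ModuleCat.of (MonoidAlgebra K S) (θ.invariants M)) where
  toFun f := ModuleCat.ofHom
    ((θ.invariantsEquiv M).symm.toLinearMap ∘ₗ Induced.toCentral θ f.hom)
  invFun g := ModuleCat.ofHom
    (Induced.ofCentral θ ((θ.invariantsEquiv M).toLinearMap ∘ₗ g.hom))
  left_inv f :=
    have h : (θ.invariantsEquiv M).toLinearMap ∘ₗ (θ.invariantsEquiv M).symm.toLinearMap ∘ₗ
        Induced.toCentral θ f.hom = Induced.toCentral θ f.hom :=
      LinearMap.ext fun _ => (θ.invariantsEquiv M).apply_symm_apply _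
    ModuleCat.hom_ext
      ((congrArg (Induced.ofCentral θ) h).trans (Induced.ofCentral_toCentral θ f.hom))
  right_inv g :=
    have h := Induced.toCentral_ofCentral θ ((θ.invariantsEquiv M).toLinearMap ∘ₗ g.hom)
    ModuleCat.hom_ext (LinearMap.ext fun v =>
      (congrArg (θ.invariantsEquiv M).symm (LinearMap.congr_fun h v)).trans
        ((θ.invariantsEquiv M).symm_apply_apply _))
  map_add' _ _ := rfl
  map_smul' k f := ModuleCat.hom_ext (LinearMap.ext fun v => by
    refine (θ.invariantsEquiv M).injective (Central.val_injective θ ?_)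
    change algebraMap K θ.Env k • f.hom (Induced.tmul θ 1 v) =
      Central.val θ (θ.invariantsEquiv M (algebraMap K (MonoidAlgebra K S) k •
        (θ.invariantsEquiv M).symm (Induced.toCentral θ f.hom v)))
    -- Scalars act on both Hom spaces through the structure maps from `K`, which `conjHom` respects.
    rw [_root_.map_smul, LinearEquiv.apply_symm_apply, Central.val_smul, AlgHom.commutes]
    rfl)

/-- Naturality of the adjunction, needed for compatibility with the differentials of the Hom
complexes. -/
theorem inducedHomEquiv_comp {V W : ModuleCat.{u} (MonoidAlgebra K S)} (p : V ⟶ W)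
    (f : θ.inducedFunctor.obj W ⟶ ModuleCat.of θ.Env M) :
    θ.inducedHomEquiv M V (θ.inducedFunctor.map p ≫ f) = p ≫ θ.inducedHomEquiv M W f :=
  ModuleCat.hom_ext (LinearMap.ext fun v => by
    refine (θ.invariantsEquiv M).injective (Central.val_injective θ ?_)
    change f.hom (Induced.map θ p.hom (Induced.tmul θ 1 v)) = f.hom (Induced.tmul θ 1 (p.hom v))
    rw [Induced.map_tmul])

/-- The isomorphism of complexes `Hom(Ind P, M) ≅ Hom(P, M^A)`. -/
noncomputable def linearYonedaObjInducedIso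
    (P : ChainComplex (ModuleCat.{u} (MonoidAlgebra K S)) ℕ) :
    ChainComplex.linearYonedaObj ((θ.inducedFunctor.mapHomologicalComplex _).obj P) K
        (ModuleCat.of θ.Env M) ≅
      P.linearYonedaObj K (ModuleCat.of (MonoidAlgebra K S) (θ.invariants M)) :=
  HomologicalComplex.Hom.isoOfComponents
    (fun i => (θ.inducedHomEquiv M (P.X i)).toModuleIso)
    fun i j _ => ModuleCat.hom_ext (LinearMap.ext fun f =>
      (θ.inducedHomEquiv_comp M (P.d j i) f).symm)

end Comparison

end UnitalAction

theorem mainTheorem10 {K S A : Type u} [Field K] [InverseMonoid S] [Ring A] [Algebra K A]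
    (θ : UnitalAction K S A) (hA : IsSeparableAlgebra K A)
    (M : Type u) [AddCommGroup M] [Module K M] [Module θ.CrossedProduct M]
    [Module θ.CrossedProductᵐᵒᵖ M] [IsScalarTower K θ.CrossedProduct M]
    [IsScalarTower K θ.CrossedProductᵐᵒᵖ M]
    [SMulCommClass θ.CrossedProduct θ.CrossedProductᵐᵒᵖ M] (n : ℕ) :
    Nonempty (InverseMonoid.cohomology K S (θ.invariants M) n ≃ₗ[K]
      hochschildCohomology K θ.CrossedProduct M n) := by
  have := θ.preservesProjectiveObjects_inducedFunctor hA
  let _ : Module θ.Env θ.CrossedProduct := θ.envModuleSelf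
  let _ : Module θ.Env M := θ.envModule M
  let P := projectiveResolution (ModuleCat.of (MonoidAlgebra K S) (Idem S →₀ K))
  let e : θ.inducedFunctor.obj (ModuleCat.of (MonoidAlgebra K S) (Idem S →₀ K)) ≅
      ModuleCat.of θ.Env θ.CrossedProduct := (UnitalAction.Induced.equivSelf θ).toModuleIso
  -- `Ext(K E(S), M^A)` is computed by `Hom(P, M^A) ≅ Hom(Ind P, M)`, hence equals `Ext(Ind K E(S),
  -- M)`; finally `e` replaces `Ind K E(S)` by the crossed product.
  let i := P.isoExt (R := K) n (ModuleCat.of (MonoidAlgebra K S) (θ.invariants M)) ≪≫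
    (HomologicalComplex.homologyFunctor _ _ n).mapIso (θ.linearYonedaObjInducedIso M P.complex).symm ≪≫
    ((θ.inducedFunctor.mapProjectiveResolution P).isoExt (R := K) n (ModuleCat.of θ.Env M)).symm ≪≫
    ((Ext K (ModuleCat.{u} θ.Env) n).mapIso e.symm.op).app (ModuleCat.of θ.Env M)
  exact ⟨i.toLinearEquiv⟩
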